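/- **Setting.** Let $G=(V,E)$, $V=\{1,\dots,n\}$, be an undirected graph with maximum degree $d$. Every node $i$ has a speed $s_i\ge 1$; put $s=\sum_i s_i$, $s_{\max}=\max_i s_i$ and $S=\mathrm{diag}(s_1,\dots,s_n)$. Let $\alpha_{i,j}=\alpha_{j,i}>0$ for $\{i,j\}\in E$ and $\alpha_{i,j}=0$ for all other pairs, with $\sum_{j}\alpha_{i,j}\le 1$ for every $i$. Let $L$ be the Laplacian with edge weights $\alpha_{i,j}$, let $M=I-LS^{-1}$ be the diffusion matrix, let $\lambda$ be its second largest eigenvalue in magnitude (with multiplicity), assume $\lambda<1$, and let $\beta=\beta_{\mathrm{opt}}=2/(1+\sqrt{1-\lambda^2})$. *The process $R=R(\mathrm{SOS})$.* Initially node $i$ holds $x_i(0)\in\mathbb{N}$ tokens. In round $t$, with current loads $x_i(t)$, the scheduled flow is $\hat Y_{i,j}(0)=\alpha_{i,j}\bigl(\frac{x_i(0)}{s_i}-\frac{x_j(0)}{s_j}\bigr)$ and, for $t\ge1$, $$\hat Y_{i,j}(t)=(\beta-1)\,y_{i,j}(t-1)+\beta\,\alpha_{i,j}\Bigl(\frac{x_i(t)}{s_i}-\frac{x_j(t)}{s_j}\Bigr).$$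 It is rounded to an integral flow $y_{i,j}(t)$ as follows, where $\{a\}=a-\lfloor a\rfloor$. Node $i$ has $r_i=\sum_{j:\hat Y_{i,j}(t)\ge0}\{\hat Y_{i,j}(t)\}$ excess load and takes $\lceil r_i\rceil$ excess tokens. Independently, each of them is sent out with probability $r_i/\lceil r_i\rceil$, and then to $j$ (with $\hat Y_{i,j}(t)\ge0$) with probability $\{\hat Y_{i,j}(t)\}/r_i$; otherwise it stays on $i$. If $Z_{i,j}(t)$ is the number of excess tokens sent from $i$ to $j$, then $y_{i,j}(t)=\lfloor\hat Y_{i,j}(t)\rfloor+Z_{i,j}(t)$ if $\hat Y_{i,j}(t)\ge0$, and $y_{i,j}(t)=-y_{j,i}(t)$ otherwise. Finally $x_i(t+1)=x_i(t)-\sum_j y_{i,j}(t)$. The transient load of $i$ in round $t$, when all outgoing flow has been sent and no incoming flow has been received, is $\breve x_i^R(t)=x_i(t)-\sum_j\max(y_{i,j}(t),0)$. With $\bar x_i=\frac{s_i}{s}\sum_j x_j(0)$, let $\Delta(0)=\max_i|x_i(0)-\bar x_i|$. **Theorem.** There is a constant $a>0$ such that for all $\varepsilon,K,\delta>0$ and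 $p\in\mathbb{N}$ there is a constant $C>0$, depending only on $\varepsilon,K,\delta,p$, with the following property. For every $n$, every network as above with $$s_{\max}\le K n^{p},\qquad \frac{d}{(1-\lambda)^{3/4}}\le K\,n^{1/2-\varepsilon},$$ every initial load with $\Delta(0)=0$ or $\Delta(0)\ge\delta$ (when all speeds are equal this always holds with $\delta=1/2$), and every round $t\ge0$, with probability at least $1-n^{-a}$ all nodes $i$ satisfy $$\breve x_i^{R}(t)\ \ge\ -\,C\cdot\frac{\sqrt n\cdot\Delta(0)+d^2}{\sqrt{1-\lambda}} .$$ -/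

import Mathlib

open scoped ENNReal

namespace LoadBalancing

/-- A heterogeneous diffusion network on the nodes `0, …, n-1`: an undirected graph, symmetric edge
parameters `α i j` (positive on the edges, extended by `0` off the edges, with sum at most `1` at
every node, so that `1 - ∑ j, α i j` is the nonnegative share kept by `i`), and speeds at least
`1`. -/
structure Network (n : ℕ) where
  graph : SimpleGraph (Fin n)
  α : Fin n → Fin n → ℝ
  speed : Fin n → ℝ
  α_symm : ∀ i j, α i j = α j i
  α_pos : ∀ i j, graph.Adj i j → 0 < α i j
  α_zero : ∀ i j, ¬ graph.Adj i j → α i j = 0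
  α_sum_le : ∀ i, ∑ j, α i j ≤ 1
  one_le_speed : ∀ i, 1 ≤ speed i

namespace Network

variable {n : ℕ} (N : Network n)

open Classical in
/-- The maximum degree `d`. -/
noncomputable def maxDeg : ℕ := N.graph.maxDegree

/-- The Laplacian `L` with edge weights `α`. -/
def laplacian : Matrix (Fin n) (Fin n) ℝ :=
  Matrix.diagonal (fun i => ∑ j, N.α i j) - Matrix.of N.α

/-- The diffusion matrix `M = I - L S⁻¹`, where `S` is the diagonal matrix of the speeds. -/
noncomputable def diffusionMatrix : Matrix (Fin n) (Fin n) ℝ :=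
  1 - N.laplacian * Matrix.diagonal (fun i => (N.speed i)⁻¹)

/-- `λ`, the second largest eigenvalue of `M` in magnitude, counted with multiplicity: the largest
absolute value left after one copy of the top eigenvalue `1` is removed from the list of
eigenvalues (and `0` if none is left). -/
noncomputable def lam : ℝ :=
  ((N.diffusionMatrix.charpoly.roots.erase 1).map (fun μ => |μ|)).fold max 0

/-- `β_opt = 2 / (1 + √(1 - λ²))`. -/
noncomputable def betaOpt : ℝ := 2 / (1 + √(1 - N.lam ^ 2))

/-- The balanced load `x̄ i = m s_i / s` for the initial load `x₀`, where `m` is the number of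
tokens and `s` is the sum of the speeds. -/
noncomputable def balanced (x₀ : Fin n → ℕ) (i : Fin n) : ℝ :=
  (∑ j, (x₀ j : ℝ)) * N.speed i / ∑ j, N.speed j

/-- `Δ(0) = ‖x(0) - x̄‖_∞` (the norm of `Fin n → ℝ` is the sup norm). -/
noncomputable def discrepancy (x₀ : Fin n → ℕ) : ℝ :=
  ‖fun i => (x₀ i : ℝ) - N.balanced x₀ i‖

/-- The flow that the continuous first order scheme schedules on the load `x`. -/
noncomputable def fosFlow (x : Fin n → ℤ) (i j : Fin n) : ℝ :=
  N.α i j * ((x i : ℝ) / N.speed i - (x j : ℝ) / N.speed j)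

/-- The flow that the continuous second order scheme with parameter `β_opt` schedules, given the
current load `x` and the flow `y` sent in the previous round. -/
noncomputable def sosFlow (x : Fin n → ℤ) (y : Fin n → Fin n → ℤ) (i j : Fin n) : ℝ :=
  (N.betaOpt - 1) * (y i j : ℝ) + N.betaOpt * N.fosFlow x i j

end Network

/-! ### Randomized rounding -/

/-- The distribution of finitely many independent random variables with distributions `p i`. -/
noncomputable def piPMF {ι : Type} [Fintype ι] [DecidableEq ι] {A : ι → Type} [∀ i, Fintype (A i)]
    (p : ∀ i, PMF (A i)) : PMF (∀ i, A i) :=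
  PMF.ofFintype (fun g => ∏ i, p i (g i)) (by
    have h := Finset.prod_univ_sum (fun i => (Finset.univ : Finset (A i))) (fun i a => p i a)
    rw [Fintype.piFinset_univ] at h
    rw [← h]
    refine Finset.prod_eq_one fun i _ => ?_
    rw [← tsum_fintype (L := .unconditional _)]
    exact (p i).tsum_coe)

section Rounding

variable {n : ℕ} (Y : Fin n → Fin n → ℝ)

/-- The fractional part of the scheduled flow from `i` to `j`, if that flow is nonnegative. -/
noncomputable def excess (i j : Fin n) : ℝ := if 0 ≤ Y i j then Int.fract (Y i j) else 0

/-- The excess load `r` of the node `i`. -/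
noncomputable def totalExcess (i : Fin n) : ℝ := ∑ j, excess Y i j

/-- The number `⌈r⌉` of excess tokens of the node `i`. -/
noncomputable def numTokens (i : Fin n) : ℕ := ⌈totalExcess Y i⌉₊

theorem excess_nonneg (i j : Fin n) : 0 ≤ excess Y i j := by
  unfold excess
  split_ifs
  · exact Int.fract_nonneg _
  · exact le_rfl

theorem totalExcess_nonneg (i : Fin n) : 0 ≤ totalExcess Y i :=
  Finset.sum_nonneg fun j _ => excess_nonneg Y i j

/-- The probabilities of the destinations of one excess token of the node `i`: it leaves `i` with
probability `r / ⌈r⌉`, and then goes to `j` with probability `{Y i j} / r`; `none` means that the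
token stays. -/
noncomputable def tokenWeight (i : Fin n) : Option (Fin n) → ℝ
  | none => 1 - totalExcess Y i / numTokens Y i
  | some j => totalExcess Y i / numTokens Y i * (excess Y i j / totalExcess Y i)

theorem tokenWeight_nonneg (i : Fin n) (o : Option (Fin n)) : 0 ≤ tokenWeight Y i o := by
  have h0 := totalExcess_nonneg Y i
  cases o with
  | none =>
    have : totalExcess Y i / numTokens Y i ≤ 1 :=
      div_le_one_of_le₀ (Nat.le_ceil _) (Nat.cast_nonneg _)
    simp only [tokenWeight]
    linarith
  | some j =>
    have := excess_nonneg Y i j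
    simp only [tokenWeight]
    positivity

theorem tokenWeight_sum (i : Fin n) : ∑ o, tokenWeight Y i o = 1 := by
  rw [Fintype.sum_option]
  simp only [tokenWeight]
  rw [← Finset.mul_sum, ← Finset.sum_div]
  change 1 - _ + _ * (totalExcess Y i / totalExcess Y i) = 1
  by_cases h : totalExcess Y i = 0
  · simp [h]
  · rw [div_self h]
    ring

/-- The distribution of the destination of one excess token of the node `i`. -/
noncomputable def tokenDest (i : Fin n) : PMF (Option (Fin n)) :=
  PMF.ofFintype (fun o => ENNReal.ofReal (tokenWeight Y i o)) (by
    rw [← ENNReal.ofReal_sum_of_nonneg fun o _ => tokenWeight_nonneg Y i o, tokenWeight_sum,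
      ENNReal.ofReal_one])

/-- The destinations of all the excess tokens of all the nodes. -/
abbrev Destinations : Type := (i : Fin n) → Fin (numTokens Y i) → Option (Fin n)

/-- `Z i j`, the number of excess tokens that `i` sends to `j`. -/
noncomputable def tokenCount (g : Destinations Y) (i j : Fin n) : ℕ :=
  (Finset.univ.filter fun b => g i b = some j).card

/-- The integral flow that results from the scheduled flow `Y` and the excess tokens. -/
noncomputable def roundedFlow (g : Destinations Y) (i j : Fin n) : ℤ :=
  if 0 ≤ Y i j then ⌊Y i j⌋ + tokenCount Y g i j else -(⌊Y j i⌋ + tokenCount Y g j i)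

/-- The distribution of the randomly rounded flow; all excess tokens choose their destinations
independently. -/
noncomputable def randomizedRounding : PMF (Fin n → Fin n → ℤ) :=
  (piPMF fun i => piPMF fun _ : Fin (numTokens Y i) => tokenDest Y i).map (roundedFlow Y)

end Rounding

/-! ### The randomized discrete second order scheme -/

/-- The state of the discrete process in one round: the load at the beginning of the round, and
the flow sent over the edges in the round. -/
@[ext]
structure State (n : ℕ) where
  load : Fin n → ℤ
  flow : Fin n → Fin n → ℤ

namespace State

variable {n : ℕ} (σ : State n)

/-- The load at the beginning of the next round. -/
def nextLoad (i : Fin n) : ℤ := σ.load i - ∑ j, σ.flow i j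

/-- The load of the node `i` in the transient state of the round, when all outgoing flow has been
sent and no incoming flow has been received. -/
def transientLoad (i : Fin n) : ℤ := σ.load i - ∑ j, max (σ.flow i j) 0

end State

/-- The distribution of the state in round `t` of the randomized discrete second order scheme
`R(SOS)` with parameter `β_opt`, started with `x₀ i` tokens on every node `i`. The first round
rounds the flow of the first order scheme. -/
noncomputable def sosLaw {n : ℕ} (N : Network n) (x₀ : Fin n → ℕ) : ℕ → PMF (State n)
  | 0 => (randomizedRounding (N.fosFlow fun i => (x₀ i : ℤ))).map
      fun y => ⟨fun i => (x₀ i : ℤ), y⟩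
  | t + 1 => (sosLaw N x₀ t).bind fun σ =>
      (randomizedRounding (N.sosFlow σ.nextLoad σ.flow)).map fun y => ⟨σ.nextLoad, y⟩

end LoadBalancing

namespace LoadBalancing

/-! ### Expectations of extended nonnegative functions -/

/-! Linear functionals of the load are propagated backwards through the rounds. Without rounding,
x(t+1) = βMx(t) - (β-1)x(t-1), so p·x(t+1) is the row `loadRow p t` applied to x(0), and the
rounding error made s rounds before the end enters through the row `sosRow p s`. Given the past, one
rounding has an exponential moment of sub-Gaussian form with exponent 16d²∑(pᵢ-c)², for every
constant c (`expect_randomizedRounding_exp_le`); constants are free because rounding only moves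
tokens. Accumulating over the rounds (`expect_sosLaw_exp_le`) leaves spectral estimates for the
rows, in the inner product weighted by the speeds, for which the averaging operator is self-adjoint.

On an eigenvalue |μ| ≤ λ the row is multiplied by a Chebyshev-type polynomial of size at most
(s+1)rˢ, r = √(β-1). For the load relative to the speed the initial row has weighted norm at most 1,
and the total variance is O(d²/(2-β)³). For the load itself the squared norm is the speed s_k, which
is too much. But the Dirichlet form of an indicator is at most 1, which bounds every row by
O(1/((2-β)²(1-λ))) whatever the speed. Interpolating between the two bounds costs only s_k^κ with κ
as small as desired (`expect_exp_load_single_le`).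

The total flow at a node is multiplied by β-1 in each round and grows by at most 4 max|relative
deviation| + d². Convexity of exp turns this into an exponential moment that is uniform in t
(`expect_exp_flow_le`).

A transient load below -2A needs a flow above A or a load more than A below balance. Markov's
inequality with θ = n^((ε-1)/2) and a union bound finish the proof: the gap assumption keeps the
variance terms bounded, while θ√nΔ(0) ≥ δn^(ε/2) beats every multiple of log n. If Δ(0) = 0, nothing
ever moves. -/

/-- The expectation of `f` under `p`. -/
noncomputable def expect {A : Type*} (p : PMF A) (f : A → ℝ≥0∞) : ℝ≥0∞ := ∑' a, p a * f a

section Expect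

variable {A B : Type*}

theorem expect_bind (p : PMF A) (q : A → PMF B) (f : B → ℝ≥0∞) :
    expect (p.bind q) f = expect p fun a => expect (q a) f := by
  simp only [expect, PMF.bind_apply, ← ENNReal.tsum_mul_right, ← ENNReal.tsum_mul_left, mul_assoc]
  exact ENNReal.tsum_comm

theorem expect_pure (a : A) (f : A → ℝ≥0∞) : expect (PMF.pure a) f = f a := by
  rw [expect, tsum_eq_single a]
  · simp
  · intro b hb
    simp [hb]

theorem expect_map (p : PMF A) (g : A → B) (f : B → ℝ≥0∞) :
    expect (p.map g) f = expect p fun a => f (g a) := by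
  rw [PMF.map, expect_bind]
  simp [expect_pure]

theorem expect_mono {p : PMF A} {f g : A → ℝ≥0∞} (h : ∀ a ∈ p.support, f a ≤ g a) :
    expect p f ≤ expect p g := by
  refine ENNReal.tsum_le_tsum fun a => ?_
  by_cases ha : p a = 0
  · simp [ha]
  · exact mul_le_mul_right (h a ((p.mem_support_iff a).2 ha)) _

theorem expect_add (p : PMF A) (f g : A → ℝ≥0∞) :
    expect p (fun a => f a + g a) = expect p f + expect p g := by
  simp only [expect, mul_add, ENNReal.tsum_add]

theorem expect_const_mul (p : PMF A) (c : ℝ≥0∞) (f : A → ℝ≥0∞) :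
    expect p (fun a => c * f a) = c * expect p f := by
  simp only [expect, mul_left_comm _ c, ENNReal.tsum_mul_left]

theorem expect_const (p : PMF A) (c : ℝ≥0∞) : expect p (fun _ => c) = c := by
  simp only [expect, ENNReal.tsum_mul_right, p.tsum_coe, one_mul]

theorem expect_sum (p : PMF A) {ι : Type*} (s : Finset ι) (f : ι → A → ℝ≥0∞) :
    expect p (fun a => ∑ i ∈ s, f i a) = ∑ i ∈ s, expect p (f i) := by
  simp only [expect, Finset.mul_sum]
  exact Summable.tsum_finsetSum fun i _ => ENNReal.summable

theorem expect_le_of_le {p : PMF A} {f : A → ℝ≥0∞} {c : ℝ≥0∞} (h : ∀ a ∈ p.support, f a ≤ c) :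
    expect p f ≤ c :=
  (expect_mono h).trans (expect_const p c).le

/-- A union bound in the form of Markov's inequality. -/
theorem one_sub_expect_le (p : PMF A) (s : Set A) (f : A → ℝ≥0∞)
    (h : ∀ a ∈ p.support, a ∉ s → 1 ≤ f a) : 1 - expect p f ≤ p.toOuterMeasure s := by
  rw [tsub_le_iff_right]
  calc (1 : ℝ≥0∞) = expect p fun _ => 1 := (expect_const p 1).symm
    _ ≤ expect p fun a => s.indicator 1 a + f a := by
      refine expect_mono fun a ha => ?_
      by_cases hs : a ∈ s
      · simp [hs]
      · simpa [hs] using h a ha hs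
    _ = _ := by
      rw [expect_add, PMF.toOuterMeasure_apply]
      congr 1
      refine tsum_congr fun a => ?_
      by_cases hs : a ∈ s <;> simp [hs]

theorem expect_piPMF_prod {ι : Type} [Fintype ι] [DecidableEq ι] {A : ι → Type}
    [∀ i, Fintype (A i)] (p : ∀ i, PMF (A i)) (f : ∀ i, A i → ℝ≥0∞) :
    expect (piPMF p) (fun g => ∏ i, f i (g i)) = ∏ i, expect (p i) (f i) := by
  simp only [expect, tsum_fintype, piPMF, PMF.ofFintype_apply, ← Finset.prod_mul_distrib]
  rw [Finset.prod_univ_sum, Fintype.piFinset_univ]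

end Expect

/-- Hoeffding's lemma for a finite distribution, with a weaker constant. -/
theorem sum_mul_exp_neg_le {ι : Type*} [Fintype ι] (w f : ι → ℝ) (A : ℝ) (hw : ∀ i, 0 ≤ w i)
    (hw1 : ∑ i, w i = 1) (hf : ∀ i, w i ≠ 0 → f i ^ 2 ≤ A) :
    ∑ i, w i * Real.exp (-f i) ≤ Real.exp (-(∑ i, w i * f i) + 4 * A) := by
  set m := ∑ i, w i * f i with hm
  -- Applied to m - f, the linear term has mean zero, so only exp(4A) remains: both f on its support
  -- and the mean m are at most √A in absolute value.
  have key : ∀ x : ℝ, Real.exp x ≤ x + Real.exp (x ^ 2) := by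
    intro x
    have h2 := Real.add_one_le_exp (x ^ 2)
    rcases le_total 1 x with h | h
    · have : Real.exp x ≤ Real.exp (x ^ 2) := Real.exp_le_exp.2 (by nlinarith)
      linarith
    · rcases le_total x (-1) with h' | h'
      · have : Real.exp x ≤ 1 := Real.exp_le_one_iff.2 (by linarith)
        nlinarith
      · have := (abs_le.1 (Real.abs_exp_sub_one_sub_id_le (abs_le.2 ⟨h', h⟩))).2
        linarith
  have hA : ∀ i, w i ≠ 0 → |f i| ≤ √A := fun i hi => Real.abs_le_sqrt (hf i hi)
  have hA0 : 0 ≤ A := by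
    obtain ⟨i, _, hi⟩ : ∃ i ∈ Finset.univ, w i ≠ 0 :=
      Finset.exists_ne_zero_of_sum_ne_zero (by rw [hw1]; exact one_ne_zero)
    exact (sq_nonneg _).trans (hf i hi)
  have hmA : |m| ≤ √A := by
    calc |m| ≤ ∑ i, |w i * f i| := Finset.abs_sum_le_sum_abs _ _
      _ ≤ ∑ i, w i * √A := by
        refine Finset.sum_le_sum fun i _ => ?_
        rw [abs_mul, abs_of_nonneg (hw i)]
        by_cases hi : w i = 0
        · simp [hi]
        · exact mul_le_mul_of_nonneg_left (hA i hi) (hw i)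
      _ = √A := by rw [← Finset.sum_mul, hw1, one_mul]
  have h1 : ∑ i, w i * Real.exp (m - f i) ≤ ∑ i, w i * ((m - f i) + Real.exp (4 * A)) := by
    refine Finset.sum_le_sum fun i _ => ?_
    by_cases hi : w i = 0
    · simp [hi]
    refine mul_le_mul_of_nonneg_left ((key _).trans ?_) (hw i)
    have h3 : (m - f i) ^ 2 ≤ 4 * A := by
      have h4 : |m - f i| ≤ 2 * √A := (abs_sub _ _).trans (by linarith [hA i hi])
      calc (m - f i) ^ 2 = |m - f i| ^ 2 := (sq_abs _).symm
        _ ≤ (2 * √A) ^ 2 := by gcongr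
        _ = 4 * A := by rw [mul_pow, Real.sq_sqrt hA0]; norm_num
    linarith [Real.exp_le_exp.2 h3]
  have h2 : ∑ i, w i * ((m - f i) + Real.exp (4 * A)) = Real.exp (4 * A) := by
    simp only [mul_add, mul_sub, Finset.sum_add_distrib, Finset.sum_sub_distrib, ← Finset.sum_mul,
      hw1, ← hm]
    ring
  calc ∑ i, w i * Real.exp (-f i) = Real.exp (-m) * ∑ i, w i * Real.exp (m - f i) := by
        rw [Finset.mul_sum]
        refine Finset.sum_congr rfl fun i _ => ?_
        rw [mul_left_comm, ← Real.exp_add]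
        ring_nf
    _ ≤ Real.exp (-m) * Real.exp (4 * A) := by
      rw [← h2]
      exact mul_le_mul_of_nonneg_left h1 (Real.exp_pos _).le
    _ = _ := by rw [← Real.exp_add]

/-! ### Flows and sums over the edges -/

namespace Network

variable {n : ℕ} (N : Network n)

/-- Antisymmetric functions on the pairs of nodes that vanish off the edges. -/
def IsFlow (Y : Fin n → Fin n → ℝ) : Prop :=
  (∀ i j, Y j i = -Y i j) ∧ ∀ i j, ¬ N.graph.Adj i j → Y i j = 0

open Classical in
theorem sum_adj_le (i : Fin n) {c : ℝ} (hc : 0 ≤ c) :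
    ∑ j, (if N.graph.Adj i j then c else 0) ≤ N.maxDeg * c := by
  rw [← Finset.sum_filter, Finset.sum_const, nsmul_eq_mul]
  refine mul_le_mul_of_nonneg_right ?_ hc
  have h := N.graph.degree_le_maxDegree i
  rw [← SimpleGraph.card_neighborFinset_eq_degree, SimpleGraph.neighborFinset_eq_filter] at h
  exact_mod_cast h

open Classical in
/-- The sum of the squared differences of `p` over the edges is controlled by the degree. -/
theorem sum_adj_sq_sub_le (p : Fin n → ℝ) (c : ℝ) :
    ∑ i, ∑ j, (if N.graph.Adj i j then (p i - p j) ^ 2 else 0) ≤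
      4 * N.maxDeg * ∑ i, (p i - c) ^ 2 := by
  have h1 : ∀ i j, (if N.graph.Adj i j then (p i - p j) ^ 2 else 0) ≤
      (if N.graph.Adj i j then 2 * (p i - c) ^ 2 else 0) +
      (if N.graph.Adj j i then 2 * (p j - c) ^ 2 else 0) := by
    intro i j
    rw [N.graph.adj_comm j i]
    split_ifs
    · nlinarith [sq_nonneg ((p i - c) + (p j - c))]
    · simp
  have h2 : ∑ i, ∑ j, (if N.graph.Adj i j then 2 * (p i - c) ^ 2 else 0) ≤
      2 * N.maxDeg * ∑ i, (p i - c) ^ 2 := by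
    rw [Finset.mul_sum]
    refine Finset.sum_le_sum fun i _ => (N.sum_adj_le i (by positivity)).trans (le_of_eq (by ring))
  calc _ ≤ ∑ i, ∑ j, ((if N.graph.Adj i j then 2 * (p i - c) ^ 2 else 0) +
      (if N.graph.Adj j i then 2 * (p j - c) ^ 2 else 0)) :=
        Finset.sum_le_sum fun i _ => Finset.sum_le_sum fun j _ => h1 i j
    _ = 2 * ∑ i, ∑ j, (if N.graph.Adj i j then 2 * (p i - c) ^ 2 else 0) := by
      simp only [Finset.sum_add_distrib]
      rw [Finset.sum_comm (f := fun i j => if N.graph.Adj j i then 2 * (p j - c) ^ 2 else 0)]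
      ring
    _ ≤ _ := by linarith

end Network

/-! ### Randomized rounding of a flow -/

section Rounding

variable {n : ℕ}

theorem mem_support_piPMF {ι : Type} [Fintype ι] [DecidableEq ι] {A : ι → Type}
    [∀ i, Fintype (A i)] {p : ∀ i, PMF (A i)} {g : ∀ i, A i} (h : g ∈ (piPMF p).support) (i : ι) :
    g i ∈ (p i).support := by
  rw [PMF.mem_support_iff, piPMF, PMF.ofFintype_apply, Finset.prod_ne_zero_iff] at h
  exact (PMF.mem_support_iff _ _).2 (h i (Finset.mem_univ i))

/-- Tokens on pairs without excess have weight zero. They must be excluded because `roundedFlow`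
would count them even where the scheduled flow vanishes. -/
theorem exists_of_mem_support_randomizedRounding {Y : Fin n → Fin n → ℝ} {y : Fin n → Fin n → ℤ}
    (h : y ∈ (randomizedRounding Y).support) :
    ∃ g, y = roundedFlow Y g ∧ ∀ i j, excess Y i j = 0 → tokenCount Y g i j = 0 := by
  rw [randomizedRounding, PMF.mem_support_map_iff] at h
  obtain ⟨g, hg, rfl⟩ := h
  refine ⟨g, rfl, fun i j hij => ?_⟩
  rw [tokenCount, Finset.card_eq_zero, Finset.filter_eq_empty_iff]
  intro b _ hb
  have h1 := mem_support_piPMF (mem_support_piPMF hg i) b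
  rw [hb, PMF.mem_support_iff, tokenDest, PMF.ofFintype_apply] at h1
  simp [tokenWeight, hij] at h1

theorem tokenCount_le (Y : Fin n → Fin n → ℝ) (g : Destinations Y) (i j : Fin n) :
    tokenCount Y g i j ≤ numTokens Y i :=
  (Finset.card_le_univ _).trans (Fintype.card_fin _).le

theorem excess_le_totalExcess (Y : Fin n → Fin n → ℝ) (i j : Fin n) :
    excess Y i j ≤ totalExcess Y i :=
  Finset.single_le_sum (fun k _ => excess_nonneg Y i k) (Finset.mem_univ j)

theorem totalExcess_le_numTokens (Y : Fin n → Fin n → ℝ) (i : Fin n) :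
    totalExcess Y i ≤ numTokens Y i := Nat.le_ceil _

variable (N : Network n) {Y : Fin n → Fin n → ℝ}

theorem numTokens_le (hY : N.IsFlow Y) (i : Fin n) : numTokens Y i ≤ N.maxDeg := by
  classical
  refine Nat.ceil_le.2 ?_
  have h := N.sum_adj_le i (zero_le_one (α := ℝ))
  rw [mul_one] at h
  refine le_trans (Finset.sum_le_sum fun j _ => ?_) h
  unfold excess
  split_ifs with h1 h2
  · exact (Int.fract_lt_one _).le
  · rw [hY.2 i j h2, Int.fract_zero]
  · exact zero_le_one
  · exact le_rfl

theorem excess_eq_zero_of_eq_zero {i j : Fin n} (h : Y i j = 0) : excess Y i j = 0 := by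
  simp [excess, h]

theorem roundedFlow_eq_zero {g : Destinations Y} {i j : Fin n} (h : Y i j = 0)
    (hg : ∀ i j, excess Y i j = 0 → tokenCount Y g i j = 0) : roundedFlow Y g i j = 0 := by
  simp [roundedFlow, h, hg i j (excess_eq_zero_of_eq_zero h)]

variable {N}

theorem eq_zero_of_mem_support_randomizedRounding {y : Fin n → Fin n → ℤ}
    (h : y ∈ (randomizedRounding Y).support) {i j : Fin n} (hij : Y i j = 0) : y i j = 0 := by
  obtain ⟨g, rfl, hg⟩ := exists_of_mem_support_randomizedRounding h
  exact roundedFlow_eq_zero hij hg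

theorem isFlow_of_mem_support_randomizedRounding (hY : N.IsFlow Y) {y : Fin n → Fin n → ℤ}
    (h : y ∈ (randomizedRounding Y).support) : N.IsFlow fun i j => (y i j : ℝ) := by
  refine ⟨fun i j => ?_, fun i j hij => by
    simp [eq_zero_of_mem_support_randomizedRounding h (hY.2 i j hij)]⟩
  have hs := hY.1 i j
  by_cases h0 : Y i j = 0
  · simp [eq_zero_of_mem_support_randomizedRounding h h0,
      eq_zero_of_mem_support_randomizedRounding h (hs.trans (by simp [h0]))]
  · obtain ⟨g, rfl, -⟩ := exists_of_mem_support_randomizedRounding h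
    simp only [roundedFlow]
    rcases lt_or_gt_of_ne h0 with h1 | h1
    · rw [if_pos (by linarith), if_neg (by linarith)]
      push_cast; ring
    · rw [if_neg (by linarith), if_pos h1.le]
      push_cast; ring

/-- The token count of a pair and its excess both lie between 0 and the number of tokens of the
sender, which is at most d. -/
theorem abs_sub_le_of_mem_support_randomizedRounding (hY : N.IsFlow Y) {y : Fin n → Fin n → ℤ}
    (h : y ∈ (randomizedRounding Y).support) (i j : Fin n) : |(y i j : ℝ) - Y i j| ≤ N.maxDeg := by
  have hfl := (isFlow_of_mem_support_randomizedRounding hY h).1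
  have key : ∀ i j, 0 ≤ Y i j → |(y i j : ℝ) - Y i j| ≤ N.maxDeg := by
    intro i j hij
    obtain ⟨g, rfl, -⟩ := exists_of_mem_support_randomizedRounding h
    have h1 : ((roundedFlow Y g i j : ℤ) : ℝ) - Y i j = tokenCount Y g i j - excess Y i j := by
      rw [roundedFlow, if_pos hij, excess, if_pos hij, Int.fract]
      push_cast; ring
    rw [h1]
    have h2 : (numTokens Y i : ℝ) ≤ N.maxDeg := by exact_mod_cast numTokens_le N hY i
    have h3 : (tokenCount Y g i j : ℝ) ≤ numTokens Y i := by exact_mod_cast tokenCount_le Y g i j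
    have h4 := excess_nonneg Y i j
    have h5 := (excess_le_totalExcess Y i j).trans (totalExcess_le_numTokens Y i)
    have h6 : (0 : ℝ) ≤ tokenCount Y g i j := Nat.cast_nonneg _
    exact abs_le.2 ⟨by linarith, by linarith⟩
  rcases le_total 0 (Y i j) with h1 | h1
  · exact key i j h1
  · have h2 := key j i (by rw [hY.1 i j]; linarith)
    have h3 := hfl i j
    simp only at h3
    rwa [h3, hY.1 i j, neg_sub_neg, abs_sub_comm] at h2

theorem sum_abs_sub_le_of_mem_support_randomizedRounding (hY : N.IsFlow Y)
    {y : Fin n → Fin n → ℤ} (h : y ∈ (randomizedRounding Y).support) (i : Fin n) :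
    ∑ j, |(y i j : ℝ) - Y i j| ≤ (N.maxDeg : ℝ) ^ 2 := by
  classical
  rw [sq]
  refine le_trans (Finset.sum_le_sum fun j _ => ?_) (N.sum_adj_le i (Nat.cast_nonneg _))
  split_ifs with hij
  · exact abs_sub_le_of_mem_support_randomizedRounding hY h i j
  · simp [eq_zero_of_mem_support_randomizedRounding h (hY.2 i j hij), hY.2 i j hij]

/-- The change of the functional `p` caused by one token that is sent from `i` to `j`. -/
noncomputable def tokenCost (Y : Fin n → Fin n → ℝ) (p : Fin n → ℝ) (i j : Fin n) : ℝ :=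
  -- If `Y i j = 0`, both orientations fall into the first branch of `roundedFlow`, so a token is
  -- counted at its sender only. This has probability zero, but the value `p i` makes the identities
  -- below hold for all destinations.
  if 0 < Y i j then p i - p j else if Y i j = 0 then p i else 0

theorem sum_tokenCost_tokenCount (p : Fin n → ℝ) (g : Destinations Y) (i : Fin n) :
    ∑ j, tokenCost Y p i j * tokenCount Y g i j =
      ∑ b, Option.elim (g i b) 0 (tokenCost Y p i) := by
  have h : ∀ b, Option.elim (g i b) 0 (tokenCost Y p i) =
      ∑ j, if g i b = some j then tokenCost Y p i j else 0 := by
    intro b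
    cases g i b <;> simp
  simp only [h]
  rw [Finset.sum_comm]
  refine Finset.sum_congr rfl fun j _ => ?_
  rw [← Finset.sum_filter, Finset.sum_const, nsmul_eq_mul, tokenCount, mul_comm]

/-- Each negative entry is the reversal of a positive one, so all flow can be charged to its sender.
This makes the functional affine in the token counts. -/
theorem sum_mul_roundedFlow (hY : N.IsFlow Y) (p : Fin n → ℝ) (g : Destinations Y) :
    ∑ i, p i * ∑ j, (roundedFlow Y g i j : ℝ) =
      ∑ i, ∑ j, tokenCost Y p i j * (⌊Y i j⌋ + tokenCount Y g i j) := by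
  set a : Fin n → Fin n → ℝ := fun i j => ⌊Y i j⌋ + tokenCount Y g i j with ha
  have h1 : ∀ i j, p i * (roundedFlow Y g i j : ℝ) =
      (if 0 ≤ Y i j then p i * a i j else 0) - (if 0 < Y j i then p i * a j i else 0) := by
    intro i j
    have := hY.1 i j
    unfold roundedFlow
    split_ifs <;> first | linarith | (push_cast; simp only [ha]; ring)
  have h2 : ∀ i j, tokenCost Y p i j * a i j =
      (if 0 ≤ Y i j then p i * a i j else 0) - (if 0 < Y i j then p j * a i j else 0) := by
    intro i j
    unfold tokenCost
    rcases lt_trichotomy (Y i j) 0 with h | h | h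
    · simp [h.not_ge, h.ne, h.not_gt]
    · simp [h]
    · simp [h, h.le]; ring
  change _ = ∑ i, ∑ j, tokenCost Y p i j * a i j
  simp only [Finset.mul_sum, h1, h2, Finset.sum_sub_distrib]
  rw [Finset.sum_comm (f := fun i j => if 0 < Y j i then p i * a j i else 0)]

theorem sum_mul_flow (hY : N.IsFlow Y) (p : Fin n → ℝ) :
    ∑ i, p i * ∑ j, Y i j = ∑ i, ∑ j, tokenCost Y p i j * (⌊Y i j⌋ + excess Y i j) := by
  have h1 : ∀ i j, p i * Y i j =
      (if 0 < Y i j then p i * Y i j else 0) - (if 0 < Y j i then p i * Y j i else 0) := by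
    intro i j
    have := hY.1 i j
    split_ifs
    · linarith
    · ring
    · rw [this]; ring
    · rw [show Y i j = 0 by linarith]; ring
  have h2 : ∀ i j, tokenCost Y p i j * (⌊Y i j⌋ + excess Y i j) =
      (if 0 < Y i j then p i * Y i j else 0) - (if 0 < Y i j then p j * Y i j else 0) := by
    intro i j
    unfold tokenCost
    split_ifs with h h0
    · rw [excess, if_pos h.le, Int.floor_add_fract]; ring
    · simp [h0, excess]
    · ring
  simp only [Finset.mul_sum]
  rw [Finset.sum_congr rfl fun i _ => Finset.sum_congr rfl fun j _ => h1 i j]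
  simp only [h2, Finset.sum_sub_distrib]
  rw [Finset.sum_comm (f := fun i j => if 0 < Y j i then p i * Y j i else 0)]

/-- The rounding is unbiased: the expected number of tokens on a pair is its excess. -/
theorem numTokens_mul_tokenWeight (i j : Fin n) :
    numTokens Y i * tokenWeight Y i (some j) = excess Y i j := by
  have h1 := totalExcess_le_numTokens Y i
  have h2 := excess_le_totalExcess Y i j
  have h3 := excess_nonneg Y i j
  unfold tokenWeight
  by_cases h : totalExcess Y i = 0
  · rw [h]; simp; linarith
  · have : (numTokens Y i : ℝ) ≠ 0 := by
      have := totalExcess_nonneg Y i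
      intro h0
      exact h (by linarith)
    field_simp

open Classical in
-- Hoeffding's lemma for one token. A token travels only along an edge with positive flow, and the
-- square of its cost is bounded crudely by the sum over all neighbours.
theorem expect_tokenDest_le (hY : N.IsFlow Y) (p : Fin n → ℝ) (i : Fin n) :
    expect (tokenDest Y i)
      (fun o => ENNReal.ofReal (Real.exp (-Option.elim o 0 (tokenCost Y p i)))) ≤
    ENNReal.ofReal (Real.exp (-(∑ j, tokenWeight Y i (some j) * tokenCost Y p i j) +
      4 * ∑ j, if N.graph.Adj i j then (p i - p j) ^ 2 else 0)) := by
  have h0 : ∀ j, 0 ≤ if N.graph.Adj i j then (p i - p j) ^ 2 else 0 := by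
    intro j
    split_ifs
    · positivity
    · exact le_rfl
  have h := sum_mul_exp_neg_le (tokenWeight Y i) (fun o => Option.elim o 0 (tokenCost Y p i))
    (∑ j, if N.graph.Adj i j then (p i - p j) ^ 2 else 0) (tokenWeight_nonneg Y i)
    (tokenWeight_sum Y i) (by
      rintro (_ | j) hj
      · simpa using Finset.sum_nonneg fun j _ => h0 j
      · have h1 : excess Y i j ≠ 0 := by
          intro h1
          simp [tokenWeight, h1] at hj
        have h2 : 0 < Y i j := by
          by_contra h2
          refine h1 ?_
          unfold excess
          split_ifs with h3
          · rw [show Y i j = 0 by linarith, Int.fract_zero]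
          · rfl
        have h3 : N.graph.Adj i j := by
          by_contra h3
          exact h2.ne' (hY.2 i j h3)
        have h4 := Finset.single_le_sum (fun j _ => h0 j) (Finset.mem_univ j)
        simpa [tokenCost, h2, h3] using h4)
  rw [expect, tsum_fintype]
  simp only [tokenDest, PMF.ofFintype_apply]
  simp only [← ENNReal.ofReal_mul (tokenWeight_nonneg Y i _)]
  rw [← ENNReal.ofReal_sum_of_nonneg fun o _ =>
    mul_nonneg (tokenWeight_nonneg Y i o) (Real.exp_pos _).le]
  refine ENNReal.ofReal_le_ofReal (h.trans_eq ?_)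
  rw [Fintype.sum_option]
  simp

/-- The exponential moment of a functional of the rounded flow. -/
theorem expect_randomizedRounding_exp_le (hY : N.IsFlow Y) (p : Fin n → ℝ) (c : ℝ) :
    expect (randomizedRounding Y)
      (fun y => ENNReal.ofReal (Real.exp (-∑ i, p i * ∑ j, (y i j : ℝ)))) ≤
    ENNReal.ofReal (Real.exp (-(∑ i, p i * ∑ j, Y i j) +
      16 * (N.maxDeg : ℝ) ^ 2 * ∑ i, (p i - c) ^ 2)) := by
  classical
  set A : Fin n → ℝ := fun i => ∑ j, if N.graph.Adj i j then (p i - p j) ^ 2 else 0 with hA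
  set F : ℝ := ∑ i, ∑ j, tokenCost Y p i j * ⌊Y i j⌋ with hF
  have hA0 : ∀ i, 0 ≤ A i := fun i => Finset.sum_nonneg fun j _ => by
    split_ifs
    · positivity
    · exact le_rfl
  rw [randomizedRounding, expect_map]
  -- The exponential factors over the tokens, so independence reduces it to single tokens.
  have h1 : ∀ g : Destinations Y,
      ENNReal.ofReal (Real.exp (-∑ i, p i * ∑ j, (roundedFlow Y g i j : ℝ))) =
      ENNReal.ofReal (Real.exp (-F)) * ∏ i, ∏ b,
        ENNReal.ofReal (Real.exp (-Option.elim (g i b) 0 (tokenCost Y p i))) := by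
    intro g
    simp only [← ENNReal.ofReal_prod_of_nonneg fun _ _ => (Real.exp_pos _).le, ← Real.exp_sum,
      ← ENNReal.ofReal_mul (Real.exp_pos _).le, ← Real.exp_add, Finset.sum_neg_distrib,
      ← sum_tokenCost_tokenCount, sum_mul_roundedFlow hY, mul_add, Finset.sum_add_distrib, ← hF]
    rw [neg_add]
  have h2 : ∀ i, expect (piPMF fun _ : Fin (numTokens Y i) => tokenDest Y i) (fun g => ∏ b,
      ENNReal.ofReal (Real.exp (-Option.elim (g b) 0 (tokenCost Y p i)))) ≤
      ENNReal.ofReal (Real.exp (-(∑ j, tokenCost Y p i j * excess Y i j) +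
        4 * N.maxDeg * A i)) := by
    intro i
    rw [expect_piPMF_prod (fun _ : Fin (numTokens Y i) => tokenDest Y i)
      (fun _ o => ENNReal.ofReal (Real.exp (-Option.elim o 0 (tokenCost Y p i))))]
    rw [Finset.prod_const, Finset.card_univ, Fintype.card_fin]
    refine (pow_le_pow_left' (expect_tokenDest_le hY p i) _).trans ?_
    rw [← ENNReal.ofReal_pow (Real.exp_pos _).le, ← Real.exp_nat_mul]
    refine ENNReal.ofReal_le_ofReal (Real.exp_le_exp.2 ?_)
    have h3 : (numTokens Y i : ℝ) ≤ N.maxDeg := by exact_mod_cast numTokens_le N hY i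
    have h4 : (numTokens Y i : ℝ) * ∑ j, tokenWeight Y i (some j) * tokenCost Y p i j =
        ∑ j, tokenCost Y p i j * excess Y i j := by
      rw [Finset.mul_sum]
      refine Finset.sum_congr rfl fun j _ => ?_
      rw [← numTokens_mul_tokenWeight]
      ring
    have h5 := mul_le_mul_of_nonneg_right h3 (hA0 i)
    rw [mul_add, mul_neg, h4]
    linarith
  simp only [h1]
  rw [expect_const_mul, expect_piPMF_prod (fun i => piPMF fun _ : Fin (numTokens Y i) =>
    tokenDest Y i) (fun i g => ∏ b,
      ENNReal.ofReal (Real.exp (-Option.elim (g b) 0 (tokenCost Y p i))))]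
  refine (mul_le_mul_right (Finset.prod_le_prod' fun i _ => h2 i) _).trans ?_
  rw [← ENNReal.ofReal_prod_of_nonneg fun _ _ => (Real.exp_pos _).le, ← Real.exp_sum,
    ← ENNReal.ofReal_mul (Real.exp_pos _).le, ← Real.exp_add]
  refine ENNReal.ofReal_le_ofReal (Real.exp_le_exp.2 ?_)
  rw [sum_mul_flow hY]
  simp only [mul_add, Finset.sum_add_distrib, Finset.sum_neg_distrib, ← Finset.mul_sum, ← hF]
  -- At most d tokens per node give the factor 4d, and the sum over the edges gives another 4d.
  have h6 := mul_le_mul_of_nonneg_left (N.sum_adj_sq_sub_le p c)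
    (by positivity : (0 : ℝ) ≤ 4 * N.maxDeg)
  linarith

end Rounding

/-! ### The spectrum of the diffusion matrix -/

namespace Network

variable {n : ℕ} (N : Network n)

theorem speed_pos (i : Fin n) : 0 < N.speed i := zero_lt_one.trans_le (N.one_le_speed i)

theorem lam_nonneg : 0 ≤ N.lam := by
  unfold lam
  refine Multiset.induction_on (Multiset.map _ _) (by simp) fun a s hs => ?_
  rw [Multiset.fold_cons_left]
  exact hs.trans (le_max_right _ _)

theorem abs_le_lam {μ : ℝ} (h : μ ∈ N.diffusionMatrix.charpoly.roots.erase 1) : |μ| ≤ N.lam := by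
  have key : ∀ (s : Multiset ℝ) (x : ℝ), x ∈ s → x ≤ s.fold max 0 := by
    intro s
    refine Multiset.induction_on s (by simp) fun a s hs x hx => ?_
    rw [Multiset.fold_cons_left]
    rcases Multiset.mem_cons.1 hx with rfl | hx
    · exact le_max_left _ _
    · exact (hs x hx).trans (le_max_right _ _)
  exact key _ _ (Multiset.mem_map_of_mem _ h)

/-- The action of the diffusion matrix on row vectors. -/
noncomputable def avg (p : Fin n → ℝ) (i : Fin n) : ℝ :=
  p i - (N.speed i)⁻¹ * ∑ j, N.α i j * (p i - p j)

/-- The inner product weighted by the speeds. -/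
noncomputable def ip (p q : Fin n → ℝ) : ℝ := ∑ i, N.speed i * p i * q i

theorem ip_sub_left (p q v : Fin n → ℝ) : N.ip (p - q) v = N.ip p v - N.ip q v := by
  simp only [ip, Pi.sub_apply, mul_sub, sub_mul, Finset.sum_sub_distrib]

theorem ip_smul_left (c : ℝ) (p v : Fin n → ℝ) : N.ip (c • p) v = c * N.ip p v := by
  simp only [ip, Pi.smul_apply, smul_eq_mul, Finset.mul_sum]
  exact Finset.sum_congr rfl fun i _ => by ring

theorem sum_sq_le_ip (p : Fin n → ℝ) : ∑ i, p i ^ 2 ≤ N.ip p p := by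
  refine Finset.sum_le_sum fun i _ => ?_
  nlinarith [N.one_le_speed i, sq_nonneg (p i)]

theorem avg_one : N.avg 1 = 1 := by
  ext i
  simp [avg]

theorem sum_laplacian_mul (p : Fin n → ℝ) (i : Fin n) :
    ∑ j, N.laplacian i j * p j = ∑ j, N.α i j * (p i - p j) := by
  simp [laplacian, sub_mul, mul_sub, Matrix.diagonal_apply, Finset.sum_mul]

/-- An eigenbasis of the diffusion matrix that is orthonormal with respect to the weighted inner
product. -/
structure Eigenbasis where
  vec : Fin n → Fin n → ℝ
  val : Fin n → ℝ
  top : Fin n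
  parseval : ∀ p q, N.ip p q = ∑ a, N.ip p (vec a) * N.ip q (vec a)
  ip_avg : ∀ p a, N.ip (N.avg p) (vec a) = val a * N.ip p (vec a)
  val_top : val top = 1
  abs_val_le : ∀ a, a ≠ top → |val a| ≤ N.lam
  ip_one_top : N.ip 1 (vec top) ≠ 0
  ip_one : ∀ a, a ≠ top → N.ip 1 (vec a) = 0

/-- The diffusion matrix in symmetric form. -/
noncomputable def symmMatrix : Matrix (Fin n) (Fin n) ℝ :=
  Matrix.diagonal (fun i => (√(N.speed i))⁻¹) * N.diffusionMatrix *
    Matrix.diagonal (fun i => √(N.speed i))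

theorem sqrt_speed_pos (i : Fin n) : 0 < √(N.speed i) := Real.sqrt_pos.2 (N.speed_pos i)

theorem symmMatrix_apply (i j : Fin n) : N.symmMatrix i j =
    (if i = j then 1 else 0) - N.laplacian i j / (√(N.speed i) * √(N.speed j)) := by
  have hi := N.sqrt_speed_pos i
  have hj := N.sqrt_speed_pos j
  have hs : N.speed j = √(N.speed j) * √(N.speed j) := (Real.mul_self_sqrt (N.speed_pos j).le).symm
  rw [symmMatrix, Matrix.mul_diagonal, Matrix.diagonal_mul, diffusionMatrix, Matrix.sub_apply,
    Matrix.mul_diagonal, Matrix.one_apply]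
  by_cases h : i = j
  · subst h
    simp only [if_true]
    generalize √(N.speed i) = q at *
    rw [hs]
    field_simp
  · simp only [h, if_false]
    generalize √(N.speed j) = q at *
    rw [hs]
    field_simp
    ring

theorem symmMatrix_isHermitian : N.symmMatrix.IsHermitian := by
  ext i j
  rw [Matrix.conjTranspose_apply, star_trivial, symmMatrix_apply, symmMatrix_apply]
  have : N.laplacian j i = N.laplacian i j := by
    simp only [laplacian, Matrix.sub_apply, Matrix.of_apply, Matrix.diagonal_apply, N.α_symm j i]
    by_cases h : i = j
    · simp [h]
    · simp [h, Ne.symm h]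
  simp [this, mul_comm, eq_comm]

theorem charpoly_symmMatrix : N.symmMatrix.charpoly = N.diffusionMatrix.charpoly := by
  rw [symmMatrix, Matrix.charpoly_mul_comm, ← mul_assoc, Matrix.diagonal_mul_diagonal]
  simp [(N.sqrt_speed_pos _).ne']

theorem symmMatrix_mulVec (p : Fin n → ℝ) :
    N.symmMatrix.mulVec (fun i => √(N.speed i) * p i) = fun i => √(N.speed i) * N.avg p i := by
  ext i
  have hi := N.sqrt_speed_pos i
  have h1 : ∀ j, N.symmMatrix i j * (√(N.speed j) * p j) =
      (if i = j then √(N.speed j) * p j else 0) - (√(N.speed i))⁻¹ * (N.laplacian i j * p j) := by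
    intro j
    have hj := N.sqrt_speed_pos j
    rw [symmMatrix_apply]
    split_ifs with h
    · subst h
      field_simp
    · field_simp
      ring
  rw [Matrix.mulVec, dotProduct]
  simp only [h1, Finset.sum_sub_distrib, ← Finset.mul_sum, sum_laplacian_mul, avg]
  rw [Finset.sum_ite_eq, if_pos (Finset.mem_univ i), mul_sub]
  congr 1
  rw [← mul_assoc]
  congr 1
  rw [← div_eq_mul_inv, eq_div_iff (N.speed_pos i).ne']
  nth_rw 2 [← Real.mul_self_sqrt (N.speed_pos i).le]
  field_simp

/-- Take an orthonormal eigenbasis of S^(-1/2) M S^(1/2) and divide by √s. Some vector is not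
orthogonal to 1; as `avg` fixes 1, its eigenvalue is 1. Erasing this copy of 1 bounds the other
eigenvalues by λ < 1, which makes their vectors orthogonal to 1. -/
theorem nonempty_eigenbasis (hn : 0 < n) (hlam : N.lam < 1) : Nonempty N.Eigenbasis := by
  set hA := N.symmMatrix_isHermitian
  set v := hA.eigenvectorBasis with hv
  set b : Fin n → Fin n → ℝ := fun a i => v a i / √(N.speed i) with hb
  have hip : ∀ p a, N.ip p (b a) =
      inner ℝ (WithLp.toLp 2 fun i => √(N.speed i) * p i : EuclideanSpace ℝ (Fin n)) (v a) := by
    intro p a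
    rw [ip, PiLp.inner_apply]
    refine Finset.sum_congr rfl fun i _ => ?_
    have hi := N.sqrt_speed_pos i
    simp only [hb, RCLike.inner_apply, conj_trivial]
    nth_rw 1 [← Real.mul_self_sqrt (N.speed_pos i).le]
    field_simp
  have hpars : ∀ p q, N.ip p q = ∑ a, N.ip p (b a) * N.ip q (b a) := by
    intro p q
    simp only [hip]
    simp only [real_inner_comm (v _) (WithLp.toLp 2 fun i => √(N.speed i) * q i)]
    rw [v.sum_inner_mul_inner, PiLp.inner_apply, ip]
    refine Finset.sum_congr rfl fun i _ => ?_
    simp only [RCLike.inner_apply, conj_trivial]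
    nth_rw 1 [← Real.mul_self_sqrt (N.speed_pos i).le]
    ring
  have havg : ∀ p a, N.ip (N.avg p) (b a) = hA.eigenvalues a * N.ip p (b a) := by
    intro p a
    simp only [hip, EuclideanSpace.inner_eq_star_dotProduct, star_trivial]
    rw [← symmMatrix_mulVec, Matrix.dotProduct_mulVec, ← Matrix.mulVec_transpose]
    have : N.symmMatrix.transpose = N.symmMatrix := by
      have := hA.eq
      rwa [Matrix.conjTranspose_eq_transpose_of_trivial] at this
    rw [this, hA.mulVec_eigenvectorBasis, smul_dotProduct, smul_eq_mul]
  have hone : 0 < N.ip 1 1 := by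
    have : Nonempty (Fin n) := ⟨⟨0, hn⟩⟩
    simp only [ip, Pi.one_apply, mul_one]
    exact Finset.sum_pos (fun i _ => N.speed_pos i) Finset.univ_nonempty
  obtain ⟨a₀, -, h0⟩ : ∃ a ∈ Finset.univ, N.ip 1 (b a) * N.ip 1 (b a) ≠ 0 :=
    Finset.exists_ne_zero_of_sum_ne_zero (by rw [← hpars]; exact hone.ne')
  have h0' : N.ip 1 (b a₀) ≠ 0 := fun h => h0 (by rw [h, zero_mul])
  have hval : ∀ a, N.ip 1 (b a) = hA.eigenvalues a * N.ip 1 (b a) := by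
    intro a
    rw [← havg, avg_one]
  have htop : hA.eigenvalues a₀ = 1 := by
    have := hval a₀
    field_simp at this
    exact this.symm
  have habs : ∀ a, a ≠ a₀ → |hA.eigenvalues a| ≤ N.lam := by
    intro a ha
    refine N.abs_le_lam ?_
    rw [← charpoly_symmMatrix, hA.roots_charpoly_eq_eigenvalues]
    have h1 : (Finset.univ : Finset (Fin n)).val = a₀ ::ₘ (Finset.univ.erase a₀).val := by
      rw [Finset.erase_val]
      exact (Multiset.cons_erase (Finset.mem_univ a₀)).symm
    rw [h1, Multiset.map_cons]
    have h2 : (RCLike.ofReal ∘ hA.eigenvalues : Fin n → ℝ) a₀ = 1 := htop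
    rw [h2, Multiset.erase_cons_head]
    exact Multiset.mem_map_of_mem (RCLike.ofReal ∘ hA.eigenvalues)
      (Finset.mem_erase.2 ⟨ha, Finset.mem_univ a⟩)
  refine ⟨⟨b, hA.eigenvalues, a₀, hpars, havg, htop, habs, h0', fun a ha => ?_⟩⟩
  have h1 := hval a
  have h2 : hA.eigenvalues a < 1 := (le_abs_self _).trans_lt ((habs a ha).trans_lt hlam)
  by_contra h3
  field_simp at h1
  linarith

namespace Eigenbasis

variable {N} (b : N.Eigenbasis)

theorem ip_self (p : Fin n → ℝ) : N.ip p p = ∑ a, N.ip p (b.vec a) ^ 2 := by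
  rw [b.parseval]
  exact Finset.sum_congr rfl fun a _ => (sq _).symm

/-- Operators that shrink all the eigenvectors but the constant one. -/
theorem exists_ip_sub_const_le {X p : Fin n → ℝ} {f : Fin n → ℝ} {B : ℝ}
    (hX : ∀ a, N.ip X (b.vec a) = f a * N.ip p (b.vec a)) (hf : ∀ a, a ≠ b.top → |f a| ≤ B) :
    ∃ c : ℝ, N.ip (X - c • (1 : Fin n → ℝ)) (X - c • (1 : Fin n → ℝ)) ≤ B ^ 2 * N.ip p p := by
  -- This constant cancels the top coefficient; the other coefficients do not see constants.
  refine ⟨N.ip X (b.vec b.top) / N.ip 1 (b.vec b.top), ?_⟩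
  rw [b.ip_self, b.ip_self, Finset.mul_sum]
  refine Finset.sum_le_sum fun a _ => ?_
  rw [N.ip_sub_left, N.ip_smul_left]
  by_cases ha : a = b.top
  · rw [ha, div_mul_cancel₀ _ b.ip_one_top]
    simp
    positivity
  · rw [b.ip_one a ha, mul_zero, sub_zero, hX, mul_pow]
    refine mul_le_mul_of_nonneg_right ?_ (sq_nonneg _)
    exact sq_le_sq' (abs_le.1 (hf a ha)).1 (abs_le.1 (hf a ha)).2

/-- Operators that are close to scalars, in terms of the Dirichlet form. -/
theorem ip_sub_smul_le (hlam : N.lam < 1) {X p : Fin n → ℝ} {f : Fin n → ℝ} {B : ℝ}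
    (hX : ∀ a, N.ip X (b.vec a) = f a * N.ip p (b.vec a))
    (hf : ∀ a, a ≠ b.top → |f a - f b.top| ≤ B) :
    N.ip (X - f b.top • p) (X - f b.top • p) ≤
      B ^ 2 / (1 - N.lam) * (N.ip p p - N.ip (N.avg p) p) := by
  have h1 : N.ip p p - N.ip (N.avg p) p = ∑ a, (1 - b.val a) * N.ip p (b.vec a) ^ 2 := by
    rw [b.ip_self, b.parseval (N.avg p), ← Finset.sum_sub_distrib]
    refine Finset.sum_congr rfl fun a _ => ?_
    rw [b.ip_avg]
    ring
  rw [h1, b.ip_self, Finset.mul_sum]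
  refine Finset.sum_le_sum fun a _ => ?_
  rw [N.ip_sub_left, N.ip_smul_left, hX, ← sub_mul, mul_pow]
  by_cases ha : a = b.top
  · rw [ha, b.val_top]
    simp
  · have h2 : (f a - f b.top) ^ 2 ≤ B ^ 2 :=
      sq_le_sq' (abs_le.1 (hf a ha)).1 (abs_le.1 (hf a ha)).2
    -- The spectral gap lets the weights of the Dirichlet form replace those of the norm.
    have h3 : 1 - N.lam ≤ 1 - b.val a := by
      linarith [(le_abs_self _).trans (b.abs_val_le a ha)]
    have h4 : 0 < 1 - N.lam := by linarith
    rw [← mul_assoc]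
    refine mul_le_mul_of_nonneg_right ?_ (sq_nonneg _)
    calc (f a - f b.top) ^ 2 ≤ B ^ 2 := h2
      _ = B ^ 2 / (1 - N.lam) * (1 - N.lam) := by field_simp
      _ ≤ _ := mul_le_mul_of_nonneg_left h3 (by positivity)

end Eigenbasis

end Network

/-! ### The polynomials of the second order scheme -/

/-- The eigenvalue after `s` rounds of the second order scheme for an eigenvalue `μ` of the
diffusion matrix. -/
noncomputable def sosPoly (β μ : ℝ) : ℕ → ℝ
  | 0 => 1
  | 1 => β * μ
  | s + 2 => β * μ * sosPoly β μ (s + 1) - (β - 1) * sosPoly β μ s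

/-- The polynomials are rˢ times Chebyshev polynomials of the second kind in cos φ. Nothing is
divided by sin φ, which may vanish; the third identity serves the induction. -/
theorem sosPoly_trig {β μ r φ : ℝ} (hr : β - 1 = r ^ 2) (hμ : β * μ = 2 * r * Real.cos φ) (s : ℕ) :
    sosPoly β μ s * Real.sin φ = r ^ s * Real.sin ((s + 1) * φ) ∧
    sosPoly β μ (s + 1) = r * Real.cos φ * sosPoly β μ s + r ^ (s + 1) * Real.cos ((s + 1) * φ) ∧
    r * Real.cos φ * sosPoly β μ (s + 1) - r ^ 2 * sosPoly β μ s =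
      r ^ (s + 2) * Real.cos ((s + 2) * φ) := by
  have third : ∀ s : ℕ, sosPoly β μ s * Real.sin φ = r ^ s * Real.sin ((s + 1) * φ) →
      sosPoly β μ (s + 1) = r * Real.cos φ * sosPoly β μ s +
        r ^ (s + 1) * Real.cos ((s + 1) * φ) →
      r * Real.cos φ * sosPoly β μ (s + 1) - r ^ 2 * sosPoly β μ s =
        r ^ (s + 2) * Real.cos ((s + 2) * φ) := by
    intro s h1 h2
    rw [h2, show ((s : ℝ) + 2) * φ = (s + 1) * φ + φ by ring, Real.cos_add]
    linear_combination (-r ^ 2 * Real.sin φ) * h1 +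
      r ^ 2 * sosPoly β μ s * (Real.sin_sq_add_cos_sq φ)
  induction s with
  | zero =>
    have h1 : sosPoly β μ 0 * Real.sin φ = r ^ 0 * Real.sin (((0 : ℕ) + 1) * φ) := by
      simp [sosPoly]
    have h2 : sosPoly β μ (0 + 1) = r * Real.cos φ * sosPoly β μ 0 +
        r ^ (0 + 1) * Real.cos (((0 : ℕ) + 1) * φ) := by
      simp [sosPoly, hμ]; ring
    exact ⟨h1, h2, third 0 h1 h2⟩
  | succ s ih =>
    obtain ⟨h1, h2, h3⟩ := ih
    have h4 : sosPoly β μ (s + 1) * Real.sin φ =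
        r ^ (s + 1) * Real.sin (((s + 1 : ℕ) + 1) * φ) := by
      rw [h2]
      push_cast
      rw [show ((s : ℝ) + 1 + 1) * φ = (s + 1) * φ + φ by ring, Real.sin_add]
      linear_combination r * Real.cos φ * h1
    have h5 : sosPoly β μ (s + 1 + 1) = r * Real.cos φ * sosPoly β μ (s + 1) +
        r ^ (s + 1 + 1) * Real.cos (((s + 1 : ℕ) + 1) * φ) := by
      push_cast
      rw [show ((s : ℝ) + 1 + 1) * φ = (s + 2) * φ by ring, ← h3, sosPoly, hr, hμ]
      ring
    exact ⟨h4, h5, third (s + 1) h4 h5⟩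

theorem abs_sosPoly_le {β μ r φ : ℝ} (hr0 : 0 ≤ r) (hr : β - 1 = r ^ 2)
    (hμ : β * μ = 2 * r * Real.cos φ) (s : ℕ) : |sosPoly β μ s| ≤ (s + 1) * r ^ s := by
  induction s with
  | zero => simp [sosPoly]
  | succ s ih =>
    rw [(sosPoly_trig hr hμ s).2.1]
    have h1 : |r * Real.cos φ * sosPoly β μ s| ≤ r * ((s + 1) * r ^ s) := by
      rw [abs_mul, abs_mul, abs_of_nonneg hr0]
      have : r * |Real.cos φ| ≤ r := mul_le_of_le_one_right hr0 (Real.abs_cos_le_one φ)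
      exact mul_le_mul this ih (abs_nonneg _) hr0
    have h2 : |r ^ (s + 1) * Real.cos ((s + 1) * φ)| ≤ r ^ (s + 1) := by
      rw [abs_mul, abs_of_nonneg (pow_nonneg hr0 _)]
      exact mul_le_of_le_one_right (pow_nonneg hr0 _) (Real.abs_cos_le_one _)
    refine (abs_add_le _ _).trans ((add_le_add h1 h2).trans_eq ?_)
    push_cast
    ring

/-- Compare with the geometric sum 1 + r + … + rˢ, whose s+1 terms are all at least rˢ. -/
theorem succ_mul_pow_le {r : ℝ} (hr0 : 0 ≤ r) (hr1 : r < 1) (s : ℕ) :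
    (s + 1) * r ^ s ≤ (1 - r)⁻¹ := by
  have h : (1 - r) * ((s + 1) * r ^ s) ≤ 1 - r ^ (s + 1) := by
    induction s with
    | zero => simp
    | succ s ih =>
      have h1 := mul_le_mul_of_nonneg_left ih hr0
      have h2 := mul_nonneg (sub_nonneg.2 hr1.le)
        (sub_nonneg.2 (pow_le_one₀ hr0 hr1.le : r ^ (s + 1) ≤ 1))
      push_cast
      rw [pow_succ r (s + 1), pow_succ r s] at *
      nlinarith
  rw [← one_div, le_div_iff₀ (by linarith)]
  linarith [pow_nonneg hr0 (s + 1)]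

/-- The bound for √r absorbs the polynomial factor and spares a factor rˢ, which keeps the sum over
s geometric. -/
theorem succ_sq_mul_pow_le {r : ℝ} (hr0 : 0 ≤ r) (hr1 : r < 1) (s : ℕ) :
    ((s + 1) * r ^ s) ^ 2 ≤ 4 / (1 - r) ^ 2 * r ^ s := by
  set y := √r with hy
  have hy2 : r = y ^ 2 := (Real.sq_sqrt hr0).symm
  have hy0 : 0 ≤ y := Real.sqrt_nonneg r
  have hy1 : y < 1 := by
    rw [hy, Real.sqrt_lt' one_pos]
    linarith
  have h1 := succ_mul_pow_le hy0 hy1 s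
  have h2 : (1 - y)⁻¹ ≤ 2 / (1 - r) := by
    rw [← one_div, div_le_div_iff₀ (by linarith) (by linarith)]
    nlinarith
  have h3 : ((s + 1) * y ^ s) ^ 2 ≤ (2 / (1 - r)) ^ 2 := by
    have : 0 ≤ (s + 1) * y ^ s := by positivity
    gcongr
    exact h1.trans h2
  calc ((s + 1) * r ^ s) ^ 2 = ((s + 1) * y ^ s) ^ 2 * r ^ s := by
        rw [hy2]; ring
    _ ≤ (2 / (1 - r)) ^ 2 * r ^ s := mul_le_mul_of_nonneg_right h3 (pow_nonneg hr0 s)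
    _ = _ := by rw [div_pow]; norm_num

theorem sum_pow_le {r : ℝ} (hr0 : 0 ≤ r) (hr1 : r < 1) (t : ℕ) :
    ∑ s ∈ Finset.range t, r ^ s ≤ (1 - r)⁻¹ := by
  rw [← tsum_geometric_of_lt_one hr0 hr1]
  exact (summable_geometric_of_lt_one hr0 hr1).sum_le_tsum _ fun s _ => pow_nonneg hr0 s

theorem sosPoly_one (β : ℝ) (s : ℕ) : sosPoly β 1 (s + 1) - (β - 1) * sosPoly β 1 s = 1 := by
  induction s with
  | zero => simp [sosPoly]
  | succ s ih =>
    rw [sosPoly]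
    linarith

/-- By `sosPoly_one` these are the partial sums of the geometric series in β - 1. -/
theorem sosPoly_one_mem {β : ℝ} (h1 : 1 ≤ β) (h2 : β < 2) (s : ℕ) :
    0 ≤ sosPoly β 1 s ∧ sosPoly β 1 s ≤ (2 - β)⁻¹ := by
  induction s with
  | zero =>
    simp only [sosPoly]
    exact ⟨zero_le_one, (one_le_inv₀ (by linarith)).2 (by linarith)⟩
  | succ s ih =>
    have h := sosPoly_one β s
    refine ⟨by nlinarith, ?_⟩
    have : (2 - β)⁻¹ = 1 + (β - 1) * (2 - β)⁻¹ := by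
      have : 2 - β ≠ 0 := by linarith
      field_simp
      ring
    nlinarith

/-! ### The optimal parameter and the size of the rows -/

namespace Network

variable {n : ℕ} (N : Network n)

/-- `2 - β_opt`, the rate at which the flow of a round is forgotten. -/
noncomputable def decay : ℝ := 2 - N.betaOpt

/-- `√(β_opt - 1)`, the convergence rate of the second order scheme. -/
noncomputable def rate : ℝ := √(N.betaOpt - 1)

theorem one_sub_lam_sq_nonneg (hlam : N.lam < 1) : 0 ≤ 1 - N.lam ^ 2 := by
  nlinarith [N.lam_nonneg]

theorem one_le_betaOpt : 1 ≤ N.betaOpt := by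
  have h0 := Real.sqrt_nonneg (1 - N.lam ^ 2)
  have h1 : √(1 - N.lam ^ 2) ≤ 1 := Real.sqrt_le_one.2 (by nlinarith [sq_nonneg N.lam])
  rw [betaOpt, le_div_iff₀ (by linarith)]
  linarith

/-- With w = √(1-λ²) ≤ 1, 2 - β equals 2w/(1+w) ≥ w. -/
theorem sqrt_one_sub_lam_le_decay (hlam : N.lam < 1) : √(1 - N.lam) ≤ N.decay := by
  have h0 := Real.sqrt_nonneg (1 - N.lam ^ 2)
  have h1 : √(1 - N.lam ^ 2) ≤ 1 := Real.sqrt_le_one.2 (by nlinarith [sq_nonneg N.lam])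
  have h2 : √(1 - N.lam) ≤ √(1 - N.lam ^ 2) := by
    refine Real.sqrt_le_sqrt ?_
    nlinarith [N.lam_nonneg]
  refine h2.trans ?_
  rw [decay, betaOpt, le_sub_iff_add_le, ← le_sub_iff_add_le', div_le_iff₀ (by linarith)]
  nlinarith

theorem sqrt_one_sub_lam_pos (hlam : N.lam < 1) : 0 < √(1 - N.lam) :=
  Real.sqrt_pos.2 (by linarith)

theorem decay_pos (hlam : N.lam < 1) : 0 < N.decay :=
  (N.sqrt_one_sub_lam_pos hlam).trans_le (N.sqrt_one_sub_lam_le_decay hlam)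

theorem decay_le_one : N.decay ≤ 1 := by
  have := N.one_le_betaOpt
  rw [decay]
  linarith

theorem rate_nonneg : 0 ≤ N.rate := Real.sqrt_nonneg _

theorem rate_sq : N.betaOpt - 1 = N.rate ^ 2 :=
  (Real.sq_sqrt (by linarith [N.one_le_betaOpt])).symm

theorem rate_lt_one (hlam : N.lam < 1) : N.rate < 1 := by
  have h1 := N.rate_sq
  have h2 := N.decay_pos hlam
  rw [decay] at h2
  nlinarith [N.rate_nonneg]

theorem decay_le_two_mul (hlam : N.lam < 1) : N.decay ≤ 2 * (1 - N.rate) := by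
  have h1 := N.rate_sq
  rw [decay]
  nlinarith [N.rate_nonneg, N.rate_lt_one hlam]

/-- This is the optimality of β: the discriminant of z² - βμz + (β-1) vanishes at μ = ±λ, so both
roots have modulus r whenever |μ| ≤ λ. -/
theorem betaOpt_mul_lam (hlam : N.lam < 1) : N.betaOpt * N.lam = 2 * N.rate := by
  have h0 := Real.sqrt_nonneg (1 - N.lam ^ 2)
  have h1 := Real.sq_sqrt (N.one_sub_lam_sq_nonneg hlam)
  have h2 := N.one_le_betaOpt
  have h3 := N.lam_nonneg
  have h4 : (N.betaOpt * N.lam) ^ 2 = (2 * N.rate) ^ 2 := by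
    rw [mul_pow 2, ← N.rate_sq, betaOpt]
    have : 1 + √(1 - N.lam ^ 2) ≠ 0 := by linarith
    field_simp
    nlinarith
  exact (sq_eq_sq₀ (by positivity) (mul_nonneg two_pos.le N.rate_nonneg)).1 h4

theorem exists_angle (hlam : N.lam < 1) {μ : ℝ} (hμ : |μ| ≤ N.lam) :
    ∃ φ, μ = N.lam * Real.cos φ ∧ N.betaOpt * μ = 2 * N.rate * Real.cos φ := by
  have h : ∃ φ, μ = N.lam * Real.cos φ := by
    rcases N.lam_nonneg.eq_or_lt with h0 | h0
    · refine ⟨0, ?_⟩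
      rw [← h0] at hμ ⊢
      simpa using hμ
    · refine ⟨Real.arccos (μ / N.lam), ?_⟩
      obtain ⟨h1, h2⟩ := abs_le.1 hμ
      rw [Real.cos_arccos (by rw [le_div_iff₀ h0]; linarith) (by rw [div_le_iff₀ h0]; linarith)]
      field_simp
  obtain ⟨φ, rfl⟩ := h
  exact ⟨φ, rfl, by rw [← mul_assoc, N.betaOpt_mul_lam hlam]⟩

theorem abs_sosPoly_le_of_abs_le (hlam : N.lam < 1) {μ : ℝ} (hμ : |μ| ≤ N.lam) (s : ℕ) :
    |sosPoly N.betaOpt μ s| ≤ (s + 1) * N.rate ^ s := by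
  obtain ⟨φ, -, h⟩ := N.exists_angle hlam hμ
  exact abs_sosPoly_le N.rate_nonneg (N.rate_sq) h s

theorem abs_sosPoly_le_inv (hlam : N.lam < 1) {μ : ℝ} (hμ : |μ| ≤ N.lam) (s : ℕ) :
    |sosPoly N.betaOpt μ s| ≤ 2 / N.decay := by
  refine (N.abs_sosPoly_le_of_abs_le hlam hμ s).trans
    ((succ_mul_pow_le N.rate_nonneg (N.rate_lt_one hlam) s).trans ?_)
  rw [← one_div, div_le_div_iff₀ (by linarith [N.rate_lt_one hlam]) (N.decay_pos hlam)]
  linarith [N.decay_le_two_mul hlam]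

/-- The second order scheme without rounding is bounded. -/
theorem abs_sosPoly_sub_le (hlam : N.lam < 1) {μ : ℝ} (hμ : |μ| ≤ N.lam) (t : ℕ) :
    |sosPoly N.betaOpt μ (t + 1) - (N.betaOpt - 1) * μ * sosPoly N.betaOpt μ t| ≤ 3 := by
  obtain ⟨φ, h1, h2⟩ := N.exists_angle hlam hμ
  have hr := N.rate_sq
  have hr0 := N.rate_nonneg
  have hr1 := N.rate_lt_one hlam
  obtain ⟨-, h3, -⟩ := sosPoly_trig hr h2 t
  have hbl := N.betaOpt_mul_lam hlam
  have hl : N.lam * (1 + N.rate ^ 2) = 2 * N.rate := by rw [← hr, ← hbl]; ring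
  -- Bounding the two terms separately would give only O(1/(1-r)). Combined, the coefficient of the
  -- polynomial is (λ-r)cos φ, and λ - r ≤ 2(1-r) compensates for its size.
  have h4 : sosPoly N.betaOpt μ (t + 1) - (N.betaOpt - 1) * μ * sosPoly N.betaOpt μ t =
      N.rate ^ (t + 1) * Real.cos ((t + 1) * φ) +
        (N.lam - N.rate) * Real.cos φ * sosPoly N.betaOpt μ t := by
    rw [h3, h1, hr]
    linear_combination (-Real.cos φ * sosPoly N.betaOpt (N.lam * Real.cos φ) t) * hl
  rw [h4]
  have h5 : |N.rate ^ (t + 1) * Real.cos ((t + 1) * φ)| ≤ 1 := by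
    rw [abs_mul, abs_of_nonneg (pow_nonneg hr0 _)]
    exact mul_le_one₀ (pow_le_one₀ hr0 hr1.le) (abs_nonneg _) (Real.abs_cos_le_one _)
  have h6 : |N.lam - N.rate| ≤ 2 * (1 - N.rate) := by
    have : (N.lam - N.rate) * (1 + N.rate ^ 2) = N.rate * (1 - N.rate ^ 2) := by
      linear_combination hl
    have h7 : 0 ≤ N.lam - N.rate := by
      by_contra h
      nlinarith [mul_nonneg hr0 (by nlinarith : 0 ≤ 1 - N.rate ^ 2)]
    rw [abs_of_nonneg h7]
    nlinarith
  have h7 : |sosPoly N.betaOpt μ t| ≤ (1 - N.rate)⁻¹ :=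
    (N.abs_sosPoly_le_of_abs_le hlam hμ t).trans (succ_mul_pow_le hr0 hr1 t)
  have h8 : |(N.lam - N.rate) * Real.cos φ * sosPoly N.betaOpt μ t| ≤ 2 := by
    rw [abs_mul, abs_mul]
    calc |N.lam - N.rate| * |Real.cos φ| * |sosPoly N.betaOpt μ t|
        ≤ (2 * (1 - N.rate)) * 1 * (1 - N.rate)⁻¹ := by
          have h9 : 0 ≤ 1 - N.rate := by linarith
          gcongr
          exact Real.abs_cos_le_one φ
      _ = 2 := by
        have h9 : 1 - N.rate ≠ 0 := by linarith
        field_simp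
  exact (abs_add_le _ _).trans (by linarith)

/-- The row vector after `s` rounds of the second order scheme. -/
noncomputable def sosRow (p : Fin n → ℝ) : ℕ → Fin n → ℝ
  | 0 => p
  | 1 => N.betaOpt • N.avg p
  | s + 2 => N.betaOpt • N.avg (sosRow p (s + 1)) - (N.betaOpt - 1) • sosRow p s

/-- The row vector after `t + 1` rounds of the second order scheme, started with a round of the
first order scheme. -/
noncomputable def loadRow (p : Fin n → ℝ) (t : ℕ) : Fin n → ℝ :=
  N.sosRow p (t + 1) - (N.betaOpt - 1) • N.avg (N.sosRow p t)

namespace Eigenbasis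

variable {N} (b : N.Eigenbasis)

theorem ip_sosRow (p : Fin n → ℝ) (a : Fin n) (s : ℕ) :
    N.ip (N.sosRow p s) (b.vec a) = sosPoly N.betaOpt (b.val a) s * N.ip p (b.vec a) := by
  have h : N.ip (N.sosRow p s) (b.vec a) = sosPoly N.betaOpt (b.val a) s * N.ip p (b.vec a) ∧
      N.ip (N.sosRow p (s + 1)) (b.vec a) =
        sosPoly N.betaOpt (b.val a) (s + 1) * N.ip p (b.vec a) := by
    induction s with
    | zero =>
      simp only [sosRow, sosPoly, N.ip_smul_left, b.ip_avg]
      exact ⟨by ring, by ring⟩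
    | succ s ih =>
      refine ⟨ih.2, ?_⟩
      rw [sosRow, sosPoly, N.ip_sub_left, N.ip_smul_left, N.ip_smul_left, b.ip_avg, ih.1, ih.2]
      ring
  exact h.1

theorem ip_loadRow (p : Fin n → ℝ) (a : Fin n) (t : ℕ) :
    N.ip (N.loadRow p t) (b.vec a) = (sosPoly N.betaOpt (b.val a) (t + 1) -
      (N.betaOpt - 1) * b.val a * sosPoly N.betaOpt (b.val a) t) * N.ip p (b.vec a) := by
  rw [loadRow, N.ip_sub_left, N.ip_smul_left, b.ip_avg, b.ip_sosRow, b.ip_sosRow]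
  ring

end Eigenbasis

/-- Modulo constants only the eigenvalues |μ| ≤ λ count. The 16 comes from 4/(1-r)² and 2 - β ≤
2(1-r). -/
theorem exists_sum_sq_sosRow_sub_le (hn : 0 < n) (hlam : N.lam < 1) (p : Fin n → ℝ) (s : ℕ) :
    ∃ c : ℝ, ∑ i, (N.sosRow p s i - c) ^ 2 ≤ 16 / N.decay ^ 2 * N.rate ^ s * N.ip p p := by
  obtain ⟨b⟩ := N.nonempty_eigenbasis hn hlam
  obtain ⟨c, hc⟩ := b.exists_ip_sub_const_le (fun a => b.ip_sosRow p a s)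
    fun a ha => N.abs_sosPoly_le_of_abs_le hlam (b.abs_val_le a ha) s
  refine ⟨c, ?_⟩
  have h1 := (N.sum_sq_le_ip _).trans hc
  simp only [Pi.sub_apply, Pi.smul_apply, Pi.one_apply, smul_eq_mul, mul_one] at h1
  refine h1.trans (mul_le_mul_of_nonneg_right ?_ ?_)
  · refine (succ_sq_mul_pow_le N.rate_nonneg (N.rate_lt_one hlam) s).trans ?_
    refine mul_le_mul_of_nonneg_right ?_ (pow_nonneg N.rate_nonneg s)
    have h2 := N.decay_le_two_mul hlam
    have h3 := N.decay_pos hlam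
    have h4 := N.rate_lt_one hlam
    rw [div_le_div_iff₀ (pow_pos (by linarith) 2) (pow_pos h3 2)]
    nlinarith
  · exact (Finset.sum_nonneg fun i _ => sq_nonneg _).trans (N.sum_sq_le_ip p)

theorem exists_sum_sq_loadRow_sub_le (hn : 0 < n) (hlam : N.lam < 1) (p : Fin n → ℝ) (t : ℕ) :
    ∃ c : ℝ, ∑ i, (N.loadRow p t i - c) ^ 2 ≤ 9 * N.ip p p := by
  obtain ⟨b⟩ := N.nonempty_eigenbasis hn hlam
  obtain ⟨c, hc⟩ := b.exists_ip_sub_const_le (fun a => b.ip_loadRow p a t)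
    fun a ha => N.abs_sosPoly_sub_le hlam (b.abs_val_le a ha) t
  refine ⟨c, ?_⟩
  have h1 := (N.sum_sq_le_ip _).trans hc
  simp only [Pi.sub_apply, Pi.smul_apply, Pi.one_apply, smul_eq_mul, mul_one] at h1
  linarith

/-- The Dirichlet form of an indicator is at most `1`, whatever the speeds. -/
theorem ip_single_sub_le (k : Fin n) :
    N.ip (Pi.single k 1) (Pi.single k 1) - N.ip (N.avg (Pi.single k 1)) (Pi.single k 1) ≤ 1 := by
  have h : ∀ p : Fin n → ℝ, N.ip p (Pi.single k 1) = N.speed k * p k := by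
    intro p
    simp [ip, Pi.single_apply]
  rw [h, h, avg, ← mul_sub, sub_sub_cancel, ← mul_assoc, mul_inv_cancel₀ (N.speed_pos k).ne',
    one_mul]
  refine le_trans (Finset.sum_le_sum fun j _ => ?_) (N.α_sum_le k)
  have h0 : 0 ≤ N.α k j := by
    by_cases h : N.graph.Adj k j
    · exact (N.α_pos k j h).le
    · exact (N.α_zero k j h).ge
  refine mul_le_of_le_one_right h0 ?_
  by_cases hj : j = k
  · simp [hj]
  · simp [hj]

theorem ip_single_self (k : Fin n) (x : ℝ) :
    N.ip (Pi.single k x) (Pi.single k x) = N.speed k * x ^ 2 := by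
  simp [ip, Pi.single_apply]
  ring

theorem sum_sq_add_le (p q : Fin n → ℝ) :
    ∑ i, p i ^ 2 ≤ 2 * ∑ i, (p i - q i) ^ 2 + 2 * ∑ i, q i ^ 2 := by
  rw [Finset.mul_sum, Finset.mul_sum, ← Finset.sum_add_distrib]
  exact Finset.sum_le_sum fun i _ => by nlinarith [sq_nonneg (p i - 2 * q i)]

theorem sum_single_sq (k : Fin n) (x : ℝ) : ∑ i, (Pi.single k x : Fin n → ℝ) i ^ 2 = x ^ 2 := by
  simp [Pi.single_apply]

/-- The row is a multiple of the indicator plus a remainder controlled by its Dirichlet form, so the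
speed does not enter; the price is 1/(1-λ) and no decay in s. The constant is 20 = 2·3² + 2·1. -/
theorem sum_sq_sosRow_single_le (hn : 0 < n) (hlam : N.lam < 1) (k : Fin n) (s : ℕ) :
    ∑ i, N.sosRow (Pi.single k 1) s i ^ 2 ≤ 20 / (N.decay ^ 2 * (1 - N.lam)) := by
  obtain ⟨b⟩ := N.nonempty_eigenbasis hn hlam
  have hd := N.decay_pos hlam
  have hl0 : 0 < 1 - N.lam := by linarith
  have hq := sosPoly_one_mem (N.one_le_betaOpt)
    (by rw [decay] at hd; linarith : N.betaOpt < 2) s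
  rw [← decay] at hq
  have h1 := b.ip_sub_smul_le hlam (fun a => b.ip_sosRow (Pi.single k 1) a s) (B := 3 / N.decay)
    (fun a ha => by
      have h2 := N.abs_sosPoly_le_inv hlam (b.abs_val_le a ha) s
      rw [b.val_top]
      refine (abs_sub _ _).trans ?_
      rw [abs_of_nonneg hq.1]
      have : 3 / N.decay = 2 / N.decay + N.decay⁻¹ := by rw [← one_div, ← add_div]; norm_num
      linarith [hq.2])
  rw [b.val_top] at h1
  have h2 := (N.sum_sq_le_ip _).trans (h1.trans (mul_le_of_le_one_right (by positivity)
    (N.ip_single_sub_le k)))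
  have h3 := sum_sq_add_le (N.sosRow (Pi.single k 1) s)
    (sosPoly N.betaOpt 1 s • Pi.single k (1 : ℝ))
  have h4 : ∑ i, (sosPoly N.betaOpt 1 s • (Pi.single k 1 : Fin n → ℝ)) i ^ 2 ≤
      1 / N.decay ^ 2 := by
    have : ∀ i, (sosPoly N.betaOpt 1 s • (Pi.single k 1 : Fin n → ℝ)) i =
        (Pi.single k (sosPoly N.betaOpt 1 s) : Fin n → ℝ) i := by
      intro i
      simp [Pi.single_apply]
    simp only [this, sum_single_sq]
    rw [one_div, ← inv_pow]
    exact pow_le_pow_left₀ hq.1 hq.2 2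
  simp only [Pi.sub_apply] at h2
  have h5 : 1 / N.decay ^ 2 ≤ 1 / (N.decay ^ 2 * (1 - N.lam)) := by
    refine one_div_le_one_div_of_le (by positivity) ?_
    exact mul_le_of_le_one_right (by positivity) (by linarith [N.lam_nonneg])
  have h6 : (3 / N.decay) ^ 2 / (1 - N.lam) = 9 * (1 / (N.decay ^ 2 * (1 - N.lam))) := by
    field_simp
    norm_num
  have h7 : 20 / (N.decay ^ 2 * (1 - N.lam)) = 20 * (1 / (N.decay ^ 2 * (1 - N.lam))) := by ring
  rw [h6] at h2
  rw [h7]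
  linarith

/-- Same splitting; the multiple is now 1 and the remainder has B = 3 + 1. The total 2·16 + 2 is
rounded up to 6². -/
theorem sum_sq_loadRow_single_le (hn : 0 < n) (hlam : N.lam < 1) (k : Fin n) (t : ℕ) :
    ∑ i, N.loadRow (Pi.single k 1) t i ^ 2 ≤ 36 / (1 - N.lam) := by
  obtain ⟨b⟩ := N.nonempty_eigenbasis hn hlam
  have hl0 : 0 < 1 - N.lam := by linarith
  have htop : sosPoly N.betaOpt (b.val b.top) (t + 1) -
      (N.betaOpt - 1) * b.val b.top * sosPoly N.betaOpt (b.val b.top) t = 1 := by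
    rw [b.val_top, mul_one, sosPoly_one]
  have h1 := b.ip_sub_smul_le hlam (fun a => b.ip_loadRow (Pi.single k 1) a t) (B := 4)
    (fun a ha => by
      have h2 := N.abs_sosPoly_sub_le hlam (b.abs_val_le a ha) t
      rw [htop]
      refine (abs_sub _ _).trans ?_
      rw [abs_one]
      linarith)
  rw [htop, one_smul] at h1
  have h2 := (N.sum_sq_le_ip _).trans (h1.trans (mul_le_of_le_one_right (by positivity)
    (N.ip_single_sub_le k)))
  have h3 := sum_sq_add_le (N.loadRow (Pi.single k 1) t) (Pi.single k (1 : ℝ))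
  rw [sum_single_sq] at h3
  simp only [Pi.sub_apply] at h2
  have h4 : 1 ≤ 1 / (1 - N.lam) := by
    rw [le_div_iff₀ hl0]
    linarith [N.lam_nonneg]
  have h5 : (4 : ℝ) ^ 2 / (1 - N.lam) = 16 * (1 / (1 - N.lam)) := by ring
  have h6 : 36 / (1 - N.lam) = 36 * (1 / (1 - N.lam)) := by ring
  rw [h6]
  rw [h5] at h2
  linarith

end Network

/-! ### Exponential moments of the load -/

namespace Network

variable {n : ℕ} (N : Network n)

theorem α_nonneg (i j : Fin n) : 0 ≤ N.α i j := by
  by_cases h : N.graph.Adj i j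
  · exact (N.α_pos i j h).le
  · exact (N.α_zero i j h).ge

theorem isFlow_fosFlow (x : Fin n → ℤ) : N.IsFlow (N.fosFlow x) := by
  refine ⟨fun i j => ?_, fun i j h => ?_⟩
  · rw [fosFlow, fosFlow, N.α_symm j i]
    ring
  · rw [fosFlow, N.α_zero i j h, zero_mul]

theorem isFlow_sosFlow (x : Fin n → ℤ) {y : Fin n → Fin n → ℤ}
    (hy : N.IsFlow fun i j => (y i j : ℝ)) : N.IsFlow (N.sosFlow x y) := by
  refine ⟨fun i j => ?_, fun i j h => ?_⟩
  · have h1 := hy.1 i j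
    simp only at h1
    rw [sosFlow, sosFlow, (N.isFlow_fosFlow x).1 i j, h1]
    ring
  · have h1 := hy.2 i j h
    simp only at h1
    rw [sosFlow, (N.isFlow_fosFlow x).2 i j h, h1]
    ring

theorem isFlow_of_mem_support_sosLaw (x₀ : Fin n → ℕ) (t : ℕ) {σ : State n}
    (h : σ ∈ (sosLaw N x₀ t).support) : N.IsFlow fun i j => (σ.flow i j : ℝ) := by
  induction t generalizing σ with
  | zero =>
    rw [sosLaw, PMF.mem_support_map_iff] at h
    obtain ⟨y, hy, rfl⟩ := h
    exact isFlow_of_mem_support_randomizedRounding (N.isFlow_fosFlow _) hy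
  | succ t ih =>
    rw [sosLaw, PMF.mem_support_bind_iff] at h
    obtain ⟨τ, hτ, h⟩ := h
    rw [PMF.mem_support_map_iff] at h
    obtain ⟨y, hy, rfl⟩ := h
    exact isFlow_of_mem_support_randomizedRounding (N.isFlow_sosFlow _ (ih hτ)) hy

/-- Summation by parts: a first order round acts on functionals through `avg`. -/
theorem sum_mul_sum_flow (p x : Fin n → ℝ) :
    ∑ i, p i * ∑ j, N.α i j * (x i / N.speed i - x j / N.speed j) = (p - N.avg p) ⬝ᵥ x := by
  have h1 : ∀ i, (p - N.avg p) i * x i = ∑ j, N.α i j * (p i - p j) * (x i / N.speed i) := by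
    intro i
    rw [← Finset.sum_mul, Pi.sub_apply, avg, sub_sub_cancel]
    ring
  have h2 : ∑ i, ∑ j, N.α i j * p i * (x j / N.speed j) =
      ∑ i, ∑ j, N.α i j * p j * (x i / N.speed i) := by
    rw [Finset.sum_comm]
    refine Finset.sum_congr rfl fun i _ => Finset.sum_congr rfl fun j _ => ?_
    rw [N.α_symm j i]
  rw [dotProduct]
  simp only [h1, Finset.mul_sum, mul_sub, sub_mul, Finset.sum_sub_distrib]
  rw [← h2]
  congr 1 <;> exact Finset.sum_congr rfl fun i _ => Finset.sum_congr rfl fun j _ => by ring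

theorem avg_dotProduct_speed (p : Fin n → ℝ) : N.avg p ⬝ᵥ N.speed = p ⬝ᵥ N.speed := by
  have h := N.sum_mul_sum_flow p N.speed
  simp only [div_self (N.speed_pos _).ne', sub_self, mul_zero, Finset.sum_const_zero,
    sub_dotProduct] at h
  linarith

theorem avg_smul (c : ℝ) (p : Fin n → ℝ) : N.avg (c • p) = c • N.avg p := by
  ext i
  simp only [avg, Pi.smul_apply, smul_eq_mul, ← mul_sub, mul_left_comm _ c, ← Finset.mul_sum]

/-- The balanced load is a multiple of the speeds, so this invariance allows loads to be replaced by
their deviations from balance. -/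
theorem loadRow_dotProduct_speed (p : Fin n → ℝ) (t : ℕ) :
    N.loadRow p t ⬝ᵥ N.speed = p ⬝ᵥ N.speed := by
  have key : ∀ t, N.sosRow p (t + 1) ⬝ᵥ N.speed -
      (N.betaOpt - 1) * (N.sosRow p t ⬝ᵥ N.speed) = p ⬝ᵥ N.speed := by
    intro t
    induction t with
    | zero =>
      simp only [sosRow, smul_dotProduct, smul_eq_mul, avg_dotProduct_speed]
      ring
    | succ t ih =>
      rw [sosRow, sub_dotProduct, smul_dotProduct, smul_dotProduct, smul_eq_mul, smul_eq_mul,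
        avg_dotProduct_speed]
      linarith
  rw [loadRow, sub_dotProduct, smul_dotProduct, avg_dotProduct_speed, smul_eq_mul, key]

theorem balanced_div_speed (x₀ : Fin n → ℕ) (i : Fin n) :
    N.balanced x₀ i / N.speed i = (∑ j, (x₀ j : ℝ)) / ∑ j, N.speed j := by
  have := (N.speed_pos i).ne'
  rw [balanced]
  field_simp

theorem balanced_nonneg (x₀ : Fin n → ℕ) (i : Fin n) : 0 ≤ N.balanced x₀ i :=
  div_nonneg (mul_nonneg (Finset.sum_nonneg fun _ _ => Nat.cast_nonneg _) (N.speed_pos i).le)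
    (Finset.sum_nonneg fun j _ => (N.speed_pos j).le)

theorem loadRow_dotProduct_balanced (p : Fin n → ℝ) (x₀ : Fin n → ℕ) (t : ℕ) :
    N.loadRow p t ⬝ᵥ N.balanced x₀ = p ⬝ᵥ N.balanced x₀ := by
  have h : N.balanced x₀ = ((∑ j, (x₀ j : ℝ)) / ∑ j, N.speed j) • N.speed := by
    ext i
    rw [balanced, Pi.smul_apply, smul_eq_mul]
    ring
  rw [h, dotProduct_smul, dotProduct_smul, loadRow_dotProduct_speed]

theorem sum_balanced_sub (hn : 0 < n) (x₀ : Fin n → ℕ) :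
    ∑ i, ((x₀ i : ℝ) - N.balanced x₀ i) = 0 := by
  have : Nonempty (Fin n) := ⟨⟨0, hn⟩⟩
  have h : ∑ j, N.speed j ≠ 0 :=
    (Finset.sum_pos (fun i _ => N.speed_pos i) Finset.univ_nonempty).ne'
  simp only [balanced, Finset.sum_sub_distrib, ← Finset.mul_sum, ← Finset.sum_div]
  field_simp
  ring

theorem abs_sub_balanced_le (x₀ : Fin n → ℕ) (i : Fin n) :
    |(x₀ i : ℝ) - N.balanced x₀ i| ≤ N.discrepancy x₀ :=
  norm_le_pi_norm (fun i => (x₀ i : ℝ) - N.balanced x₀ i) i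

theorem discrepancy_nonneg (x₀ : Fin n → ℕ) : 0 ≤ N.discrepancy x₀ := norm_nonneg _

/-- The deviations sum to zero, so w may be shifted by c before Cauchy–Schwarz; √n is the passage
from the sup norm to the Euclidean norm. -/
theorem abs_dotProduct_sub_balanced_le (hn : 0 < n) (x₀ : Fin n → ℕ) {w : Fin n → ℝ} {c B : ℝ}
    (hB : 0 ≤ B) (hw : ∑ i, (w i - c) ^ 2 ≤ B ^ 2) :
    |w ⬝ᵥ fun i => (x₀ i : ℝ) - N.balanced x₀ i| ≤ B * (√n * N.discrepancy x₀) := by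
  have h1 : (w ⬝ᵥ fun i => (x₀ i : ℝ) - N.balanced x₀ i) =
      ∑ i, (w i - c) * ((x₀ i : ℝ) - N.balanced x₀ i) := by
    simp only [sub_mul _ c, Finset.sum_sub_distrib, ← Finset.mul_sum, N.sum_balanced_sub hn]
    simp [dotProduct]
  have h0 := N.discrepancy_nonneg x₀
  refine abs_le_of_sq_le_sq ?_ (by positivity)
  rw [h1]
  refine (Finset.sum_mul_sq_le_sq_mul_sq _ _ _).trans ?_
  rw [mul_pow, mul_pow, Real.sq_sqrt (Nat.cast_nonneg n)]
  refine mul_le_mul hw ?_ (Finset.sum_nonneg fun i _ => sq_nonneg _) (sq_nonneg _)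
  calc ∑ i, ((x₀ i : ℝ) - N.balanced x₀ i) ^ 2 ≤ ∑ _i : Fin n, N.discrepancy x₀ ^ 2 := by
        refine Finset.sum_le_sum fun i _ => ?_
        rw [← sq_abs]
        exact pow_le_pow_left₀ (abs_nonneg _) (N.abs_sub_balanced_le x₀ i) 2
    _ = _ := by simp

theorem expect_rounding_exp_le {Y : Fin n → Fin n → ℝ} (hY : N.IsFlow Y) (A : ℝ) (p : Fin n → ℝ)
    (c : ℝ) :
    expect (randomizedRounding Y)
      (fun y => ENNReal.ofReal (Real.exp (A - ∑ i, p i * ∑ j, (y i j : ℝ)))) ≤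
    ENNReal.ofReal (Real.exp (A - ∑ i, p i * ∑ j, Y i j +
      16 * (N.maxDeg : ℝ) ^ 2 * ∑ i, (p i - c) ^ 2)) := by
  simp only [sub_eq_add_neg A, Real.exp_add A, ENNReal.ofReal_mul (Real.exp_pos A).le]
  rw [expect_const_mul, add_assoc, Real.exp_add A, ENNReal.ofReal_mul (Real.exp_pos A).le]
  exact mul_le_mul_right (expect_randomizedRounding_exp_le hY p c) _

/-- The net outflow of the previous round is a difference of loads, so pairs of functionals of two
consecutive loads are closed under the scheme. Averaging over the last rounding costs the index 0
term and shifts `P`, which is therefore arbitrary. The first order flow of round 0 produces the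
correction by `avg (P t)`. -/
theorem expect_sosLaw_exp_le (x₀ : Fin n → ℕ) (t : ℕ) (P : ℕ → Fin n → ℝ) (c : ℕ → ℝ)
    (hP : ∀ s, P (s + 2) = N.betaOpt • N.avg (P (s + 1)) - (N.betaOpt - 1) • P s) :
    expect (sosLaw N x₀ t) (fun σ => ENNReal.ofReal (Real.exp
      ((P 0 ⬝ᵥ fun i => (σ.nextLoad i : ℝ)) +
        (P 1 - N.betaOpt • N.avg (P 0)) ⬝ᵥ fun i => (σ.load i : ℝ)))) ≤
    ENNReal.ofReal (Real.exp
      (((P (t + 1) - (N.betaOpt - 1) • N.avg (P t)) ⬝ᵥ fun i => (x₀ i : ℝ)) +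
        16 * (N.maxDeg : ℝ) ^ 2 * ∑ s ∈ Finset.range (t + 1), ∑ i, (P s i - c s) ^ 2)) := by
  have hnext : ∀ (p : Fin n → ℝ) (σ : State n), (p ⬝ᵥ fun i => (σ.nextLoad i : ℝ)) =
      (p ⬝ᵥ fun i => (σ.load i : ℝ)) - ∑ i, p i * ∑ j, (σ.flow i j : ℝ) := by
    intro p σ
    simp only [dotProduct, State.nextLoad]
    push_cast
    simp only [mul_sub, Finset.sum_sub_distrib]
  induction t generalizing P c with
  | zero =>
    rw [sosLaw, expect_map]
    simp only [hnext]
    have h1 := N.expect_rounding_exp_le (N.isFlow_fosFlow fun i => (x₀ i : ℤ))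
      ((P 0 + (P 1 - N.betaOpt • N.avg (P 0))) ⬝ᵥ fun i => (x₀ i : ℝ)) (P 0) (c 0)
    refine le_trans (le_of_eq ?_) (h1.trans (ENNReal.ofReal_le_ofReal (Real.exp_le_exp.2
      (le_of_eq ?_))))
    · congr 1
      ext y
      rw [add_dotProduct]
      simp only [Int.cast_natCast]
      congr 2
      ring
    · simp only [fosFlow, Int.cast_natCast]
      rw [N.sum_mul_sum_flow (P 0) fun i => (x₀ i : ℝ)]
      simp only [add_dotProduct, sub_dotProduct, smul_dotProduct, smul_eq_mul, zero_add,
        Finset.range_one, Finset.sum_singleton]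
      ring
  | succ t ih =>
    rw [sosLaw, expect_bind]
    have ih' := ih (fun s => P (s + 1)) (fun s => c (s + 1)) fun s => hP (s + 1)
    set B : ℝ := 16 * (N.maxDeg : ℝ) ^ 2 * ∑ i, (P 0 i - c 0) ^ 2 with hB
    have h1 : ∀ σ ∈ (sosLaw N x₀ t).support,
        expect ((randomizedRounding (N.sosFlow σ.nextLoad σ.flow)).map
          fun y => (⟨σ.nextLoad, y⟩ : State n)) (fun σ => ENNReal.ofReal (Real.exp
          ((P 0 ⬝ᵥ fun i => (σ.nextLoad i : ℝ)) +
            (P 1 - N.betaOpt • N.avg (P 0)) ⬝ᵥ fun i => (σ.load i : ℝ)))) ≤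
        ENNReal.ofReal (Real.exp B) * ENNReal.ofReal (Real.exp
          ((P 1 ⬝ᵥ fun i => (σ.nextLoad i : ℝ)) +
            (P 2 - N.betaOpt • N.avg (P 1)) ⬝ᵥ fun i => (σ.load i : ℝ))) := by
      intro σ hσ
      rw [expect_map]
      have h2 := N.expect_rounding_exp_le
        (N.isFlow_sosFlow σ.nextLoad (N.isFlow_of_mem_support_sosLaw x₀ t hσ))
        ((P 0 + (P 1 - N.betaOpt • N.avg (P 0))) ⬝ᵥ fun i => (σ.nextLoad i : ℝ)) (P 0) (c 0)
      refine le_trans (le_of_eq ?_) (h2.trans ?_)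
      · congr 1
        ext y
        rw [add_dotProduct, hnext _ ⟨σ.nextLoad, y⟩]
        congr 2
        ring
      · rw [← ENNReal.ofReal_mul (Real.exp_pos _).le, ← Real.exp_add]
        refine ENNReal.ofReal_le_ofReal (Real.exp_le_exp.2 (le_of_eq ?_))
        have h3 : ∑ i, P 0 i * ∑ j, N.sosFlow σ.nextLoad σ.flow i j =
            (N.betaOpt - 1) * ∑ i, P 0 i * ∑ j, (σ.flow i j : ℝ) +
            N.betaOpt * ((P 0 - N.avg (P 0)) ⬝ᵥ fun i => (σ.nextLoad i : ℝ)) := by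
          rw [← N.sum_mul_sum_flow]
          simp only [sosFlow, fosFlow, Finset.sum_add_distrib, ← Finset.mul_sum, mul_add,
            mul_left_comm (P 0 _)]
        have h4 := hnext (P 0) σ
        rw [h3, hP 0]
        simp only [add_dotProduct, sub_dotProduct, smul_dotProduct, smul_eq_mul, zero_add]
        linear_combination (1 - N.betaOpt) * h4
    refine (expect_mono h1).trans ?_
    rw [expect_const_mul]
    refine (mul_le_mul_right ih' _).trans ?_
    rw [← ENNReal.ofReal_mul (Real.exp_pos _).le, ← Real.exp_add]
    refine ENNReal.ofReal_le_ofReal (Real.exp_le_exp.2 (le_of_eq ?_))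
    rw [Finset.sum_range_succ' _ (t + 1), hB]
    ring

/-- The exponential moments of the deviation of a functional of the load from balance. -/
theorem expect_exp_load_le (hn : 0 < n) (x₀ : Fin n → ℕ) (t : ℕ) (p : Fin n → ℝ) (θ : ℝ) {B : ℝ}
    (hB : 0 ≤ B) (hp : ∃ c : ℝ, ∑ i, (N.loadRow p t i - c) ^ 2 ≤ B ^ 2) {v : ℕ → ℝ}
    (hv : ∀ s, ∃ c : ℝ, ∑ i, (N.sosRow p s i - c) ^ 2 ≤ v s) :
    expect (sosLaw N x₀ t) (fun σ => ENNReal.ofReal (Real.exp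
      (θ * (p ⬝ᵥ fun i => (σ.nextLoad i : ℝ) - N.balanced x₀ i)))) ≤
    ENNReal.ofReal (Real.exp (|θ| * (B * (√n * N.discrepancy x₀)) +
      16 * (N.maxDeg : ℝ) ^ 2 * (θ ^ 2 * ∑ s ∈ Finset.range (t + 1), v s))) := by
  choose c hc using hv
  obtain ⟨c', hc'⟩ := hp
  have h1 := N.expect_sosLaw_exp_le x₀ t (fun s => θ • N.sosRow p s) (fun s => θ * c s)
    (fun s => by
      simp only [sosRow, avg_smul, smul_sub]
      rw [smul_comm θ, smul_comm θ])
  -- The first two rows are chosen so that the earlier load drops out.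
  have h2 : θ • N.sosRow p 1 - N.betaOpt • N.avg (θ • N.sosRow p 0) = 0 := by
    simp only [sosRow, avg_smul]
    rw [smul_comm θ, sub_self]
  have h3 : θ • N.sosRow p (t + 1) - (N.betaOpt - 1) • N.avg (θ • N.sosRow p t) =
      θ • N.loadRow p t := by
    rw [loadRow, avg_smul, smul_sub, smul_comm θ (N.betaOpt - 1)]
  rw [h2, h3] at h1
  have h4 : ∀ x : Fin n → ℝ, (p ⬝ᵥ fun i => x i - N.balanced x₀ i) =
      (p ⬝ᵥ fun i => x i) - p ⬝ᵥ N.balanced x₀ := by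
    intro x
    rw [← dotProduct_sub]
    rfl
  have h5 : ∀ σ : State n, ENNReal.ofReal (Real.exp
      (θ * (p ⬝ᵥ fun i => (σ.nextLoad i : ℝ) - N.balanced x₀ i))) =
      ENNReal.ofReal (Real.exp (-(θ * (p ⬝ᵥ N.balanced x₀)))) * ENNReal.ofReal (Real.exp
      (((θ • N.sosRow p 0) ⬝ᵥ fun i => (σ.nextLoad i : ℝ)) +
        (0 : Fin n → ℝ) ⬝ᵥ fun i => (σ.load i : ℝ))) := by
    intro σ
    rw [← ENNReal.ofReal_mul (Real.exp_pos _).le, ← Real.exp_add, h4 fun i => (σ.nextLoad i : ℝ)]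
    congr 2
    rw [zero_dotProduct, smul_dotProduct, smul_eq_mul, sosRow]
    ring
  simp only [h5]
  rw [expect_const_mul]
  refine (mul_le_mul_right h1 _).trans ?_
  rw [← ENNReal.ofReal_mul (Real.exp_pos _).le, ← Real.exp_add]
  refine ENNReal.ofReal_le_ofReal (Real.exp_le_exp.2 ?_)
  rw [← add_assoc]
  refine add_le_add ?_ (mul_le_mul_of_nonneg_left ?_ (by positivity))
  · have h6 := N.abs_dotProduct_sub_balanced_le hn x₀ hB hc'
    have h7 : -(θ * (p ⬝ᵥ N.balanced x₀)) + (θ • N.loadRow p t) ⬝ᵥ (fun i => (x₀ i : ℝ)) =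
        θ * (N.loadRow p t ⬝ᵥ fun i => (x₀ i : ℝ) - N.balanced x₀ i) := by
      rw [← N.loadRow_dotProduct_balanced p x₀ t, smul_dotProduct, smul_eq_mul]
      have : (N.loadRow p t ⬝ᵥ fun i => (x₀ i : ℝ) - N.balanced x₀ i) =
          (N.loadRow p t ⬝ᵥ fun i => (x₀ i : ℝ)) - N.loadRow p t ⬝ᵥ N.balanced x₀ := by
        rw [← dotProduct_sub]
        rfl
      rw [this]
      ring
    rw [h7]
    refine (le_abs_self _).trans ?_
    rw [abs_mul]
    exact mul_le_mul_of_nonneg_left h6 (abs_nonneg _)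
  · rw [Finset.mul_sum]
    refine Finset.sum_le_sum fun s _ => ?_
    simp only [Pi.smul_apply, smul_eq_mul, ← mul_sub, mul_pow, ← Finset.mul_sum]
    exact mul_le_mul_of_nonneg_left (hc s) (sq_nonneg θ)

theorem inv_one_sub_rate_le (hlam : N.lam < 1) : (1 - N.rate)⁻¹ ≤ 2 / N.decay := by
  rw [← one_div, div_le_div_iff₀ (by linarith [N.rate_lt_one hlam]) (N.decay_pos hlam)]
  linarith [N.decay_le_two_mul hlam]

/-- The load of a node relative to its speed. -/
theorem expect_exp_load_div_speed_le (hn : 0 < n) (hlam : N.lam < 1) (x₀ : Fin n → ℕ) (t : ℕ)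
    (k : Fin n) (θ : ℝ) :
    expect (sosLaw N x₀ t) (fun σ => ENNReal.ofReal (Real.exp
      (θ * (((σ.nextLoad k : ℝ) - N.balanced x₀ k) / N.speed k)))) ≤
    ENNReal.ofReal (Real.exp (|θ| * (3 * (√n * N.discrepancy x₀)) +
      512 * ((N.maxDeg : ℝ) ^ 2 * θ ^ 2 / N.decay ^ 3))) := by
  have hd := N.decay_pos hlam
  have hr0 := N.rate_nonneg
  have hr1 := N.rate_lt_one hlam
  have hp : N.ip (Pi.single k (N.speed k)⁻¹) (Pi.single k (N.speed k)⁻¹) ≤ 1 := by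
    have h := N.one_le_speed k
    have h0 := (N.speed_pos k).ne'
    rw [N.ip_single_self, sq, ← mul_assoc, mul_inv_cancel₀ h0, one_mul]
    exact inv_le_one_of_one_le₀ h
  have h1 := N.expect_exp_load_le hn x₀ t (Pi.single k (N.speed k)⁻¹) θ (B := 3) (by norm_num)
    (by
      obtain ⟨c, hc⟩ := N.exists_sum_sq_loadRow_sub_le hn hlam (Pi.single k (N.speed k)⁻¹) t
      exact ⟨c, hc.trans (by linarith)⟩)
    (v := fun s => 16 / N.decay ^ 2 * N.rate ^ s)
    (fun s => by
      obtain ⟨c, hc⟩ := N.exists_sum_sq_sosRow_sub_le hn hlam (Pi.single k (N.speed k)⁻¹) s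
      exact ⟨c, hc.trans (mul_le_of_le_one_right (by positivity) hp)⟩)
  simp only [single_dotProduct] at h1
  refine le_trans (le_of_eq ?_) (h1.trans (ENNReal.ofReal_le_ofReal (Real.exp_le_exp.2 ?_)))
  · congr 1
    ext σ
    rw [div_eq_inv_mul]
  · have h2 : ∑ s ∈ Finset.range (t + 1), 16 / N.decay ^ 2 * N.rate ^ s ≤ 32 / N.decay ^ 3 := by
      rw [← Finset.mul_sum]
      calc _ ≤ 16 / N.decay ^ 2 * (2 / N.decay) :=
            mul_le_mul_of_nonneg_left ((sum_pow_le hr0 hr1 _).trans (N.inv_one_sub_rate_le hlam))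
              (by positivity)
        _ = _ := by field_simp; norm_num
    have h3 : 16 * (N.maxDeg : ℝ) ^ 2 * (θ ^ 2 * ∑ s ∈ Finset.range (t + 1),
        16 / N.decay ^ 2 * N.rate ^ s) ≤ 16 * (N.maxDeg : ℝ) ^ 2 * (θ ^ 2 * (32 / N.decay ^ 3)) := by
      gcongr
    have h4 : 16 * (N.maxDeg : ℝ) ^ 2 * (θ ^ 2 * (32 / N.decay ^ 3)) =
        512 * ((N.maxDeg : ℝ) ^ 2 * θ ^ 2 / N.decay ^ 3) := by ring
    linarith

/-- The load of a node. A positive power `κ` of the speed is the only loss. -/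
theorem expect_exp_load_single_le (hn : 0 < n) (hlam : N.lam < 1) (x₀ : Fin n → ℕ) (t : ℕ)
    (k : Fin n) (θ : ℝ) {κ : ℝ} (hκ0 : 0 < κ) (hκ1 : κ ≤ 1) :
    expect (sosLaw N x₀ t) (fun σ => ENNReal.ofReal (Real.exp
      (θ * ((σ.nextLoad k : ℝ) - N.balanced x₀ k)))) ≤
    ENNReal.ofReal (Real.exp (|θ| * (6 / √(1 - N.lam) * (√n * N.discrepancy x₀)) +
      640 / κ * ((N.maxDeg : ℝ) ^ 2 * θ ^ 2 * N.speed k ^ κ /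
        (N.decay ^ 3 * (1 - N.lam))))) := by
  have hd := N.decay_pos hlam
  have hr0 := N.rate_nonneg
  have hr1 := N.rate_lt_one hlam
  have hl0 : 0 < 1 - N.lam := by linarith
  have hs0 := N.speed_pos k
  set D : ℝ := 20 / (N.decay ^ 2 * (1 - N.lam)) with hD
  have hD0 : 0 < D := by positivity
  set ρ : ℝ := N.rate ^ κ with hρ
  have hρ0 : 0 ≤ ρ := Real.rpow_nonneg hr0 κ
  -- Bernoulli's inequality: the interpolated series with ratio r^κ loses only a factor 1/κ.
  have hρ1 : ρ ≤ 1 - κ * (1 - N.rate) := by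
    have := rpow_one_add_le_one_add_mul_self (s := N.rate - 1) (by linarith) hκ0.le hκ1
    rw [add_sub_cancel] at this
    linarith
  have hκr : 0 < κ * (1 - N.rate) := mul_pos hκ0 (by linarith)
  have h1 := N.expect_exp_load_le hn x₀ t (Pi.single k 1) θ (B := 6 / √(1 - N.lam))
    (by positivity)
    ⟨0, by
      simp only [sub_zero]
      refine (N.sum_sq_loadRow_single_le hn hlam k t).trans_eq ?_
      rw [div_pow, Real.sq_sqrt hl0.le]
      norm_num⟩
    (v := fun s => D * (N.speed k ^ κ * ρ ^ s))
    (fun s => by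
      have e1 : N.speed k ^ κ * ρ ^ s = (N.speed k * N.rate ^ s) ^ κ := by
        rw [Real.mul_rpow hs0.le (pow_nonneg hr0 s), hρ, ← Real.rpow_natCast, ← Real.rpow_natCast,
          ← Real.rpow_mul hr0, ← Real.rpow_mul hr0, mul_comm κ]
      have e0 : 0 ≤ N.speed k * N.rate ^ s := by positivity
      -- With u = s_k rˢ, the two row bounds are at most D and Du; both regimes are covered by
      -- min(1, u) ≤ u^κ.
      rcases le_total 1 (N.speed k * N.rate ^ s) with h | h
      · refine ⟨0, ?_⟩
        simp only [sub_zero]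
        refine (N.sum_sq_sosRow_single_le hn hlam k s).trans ?_
        rw [e1]
        exact le_mul_of_one_le_right hD0.le (Real.one_le_rpow h hκ0.le)
      · obtain ⟨c, hc⟩ := N.exists_sum_sq_sosRow_sub_le hn hlam (Pi.single k 1) s
        refine ⟨c, hc.trans ?_⟩
        rw [N.ip_single_self, e1, one_pow, mul_one]
        have e2 : N.speed k * N.rate ^ s ≤ (N.speed k * N.rate ^ s) ^ κ := by
          rcases e0.eq_or_lt with e3 | e3
          · rw [← e3, Real.zero_rpow hκ0.ne']
          · simpa using Real.rpow_le_rpow_of_exponent_ge e3 h hκ1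
        have e4 : 16 / N.decay ^ 2 ≤ D := by
          rw [hD, div_le_div_iff₀ (by positivity) (by positivity)]
          have : N.decay ^ 2 * (1 - N.lam) ≤ N.decay ^ 2 :=
            mul_le_of_le_one_right (by positivity) (by linarith [N.lam_nonneg])
          nlinarith [sq_nonneg N.decay]
        calc 16 / N.decay ^ 2 * N.rate ^ s * N.speed k
            = 16 / N.decay ^ 2 * (N.speed k * N.rate ^ s) := by ring
          _ ≤ D * (N.speed k * N.rate ^ s) ^ κ := by gcongr)
  simp only [single_dotProduct, one_mul] at h1
  refine h1.trans (ENNReal.ofReal_le_ofReal (Real.exp_le_exp.2 ?_))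
  have h2 : ∑ s ∈ Finset.range (t + 1), D * (N.speed k ^ κ * ρ ^ s) ≤
      D * (N.speed k ^ κ * (2 / (κ * N.decay))) := by
    rw [← Finset.mul_sum, ← Finset.mul_sum]
    have h3 : (1 - ρ)⁻¹ ≤ 2 / (κ * N.decay) := by
      calc (1 - ρ)⁻¹ ≤ (κ * (1 - N.rate))⁻¹ := inv_anti₀ hκr (by linarith)
        _ = κ⁻¹ * (1 - N.rate)⁻¹ := mul_inv _ _
        _ ≤ κ⁻¹ * (2 / N.decay) :=
          mul_le_mul_of_nonneg_left (N.inv_one_sub_rate_le hlam) (by positivity)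
        _ = _ := by field_simp
    have h4 := (sum_pow_le hρ0 (by linarith) (t + 1)).trans h3
    have h5 : 0 ≤ N.speed k ^ κ := by positivity
    gcongr
  have h6 : 16 * (N.maxDeg : ℝ) ^ 2 * (θ ^ 2 * ∑ s ∈ Finset.range (t + 1),
      D * (N.speed k ^ κ * ρ ^ s)) ≤
      16 * (N.maxDeg : ℝ) ^ 2 * (θ ^ 2 * (D * (N.speed k ^ κ * (2 / (κ * N.decay))))) := by
    gcongr
  have h7 : 16 * (N.maxDeg : ℝ) ^ 2 * (θ ^ 2 * (D * (N.speed k ^ κ * (2 / (κ * N.decay))))) =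
      640 / κ * ((N.maxDeg : ℝ) ^ 2 * θ ^ 2 * N.speed k ^ κ / (N.decay ^ 3 * (1 - N.lam))) := by
    rw [hD]
    field_simp
    ring
  linarith

end Network

/-! ### Exponential moments of the flow -/

namespace Network

variable {n : ℕ} (N : Network n)

/-- The balanced load divided by the speed is the same at all nodes, so only relative deviations
drive the flow. -/
theorem sum_abs_fosFlow_le (x₀ : Fin n → ℕ) (x : Fin n → ℤ) {M : ℝ}
    (hM : ∀ j, |((x j : ℝ) - N.balanced x₀ j) / N.speed j| ≤ M) (i : Fin n) :
    ∑ j, |N.fosFlow x i j| ≤ 2 * M := by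
  have hM0 : 0 ≤ M := (abs_nonneg _).trans (hM i)
  have h : ∀ j, |N.fosFlow x i j| ≤ N.α i j * (2 * M) := by
    intro j
    have h1 : (x i : ℝ) / N.speed i - (x j : ℝ) / N.speed j =
        ((x i : ℝ) - N.balanced x₀ i) / N.speed i - ((x j : ℝ) - N.balanced x₀ j) / N.speed j := by
      rw [sub_div, sub_div, balanced_div_speed, balanced_div_speed]
      ring
    rw [fosFlow, abs_mul, abs_of_nonneg (N.α_nonneg i j), h1]
    refine mul_le_mul_of_nonneg_left ((abs_sub _ _).trans ?_) (N.α_nonneg i j)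
    linarith [hM i, hM j]
  refine (Finset.sum_le_sum fun j _ => h j).trans ?_
  rw [← Finset.sum_mul]
  exact mul_le_of_le_one_left (by positivity) (N.α_sum_le i)

theorem sum_abs_le_of_mem_support {Y : Fin n → Fin n → ℝ} (hY : N.IsFlow Y)
    {y : Fin n → Fin n → ℤ} (h : y ∈ (randomizedRounding Y).support) (i : Fin n) :
    ∑ j, |(y i j : ℝ)| ≤ ∑ j, |Y i j| + (N.maxDeg : ℝ) ^ 2 := by
  refine le_trans ?_
    (add_le_add_right (sum_abs_sub_le_of_mem_support_randomizedRounding hY h i) _)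
  rw [← Finset.sum_add_distrib]
  refine Finset.sum_le_sum fun j _ => ?_
  calc |(y i j : ℝ)| = |Y i j + ((y i j : ℝ) - Y i j)| := by ring_nf
    _ ≤ _ := abs_add_le _ _

theorem sum_abs_sosFlow_le (hlam : N.lam < 1) (x₀ : Fin n → ℕ) (x : Fin n → ℤ)
    (y : Fin n → Fin n → ℤ) {M : ℝ}
    (hM : ∀ j, |((x j : ℝ) - N.balanced x₀ j) / N.speed j| ≤ M) (i : Fin n) :
    ∑ j, |N.sosFlow x y i j| ≤ (1 - N.decay) * ∑ j, |(y i j : ℝ)| + 4 * M := by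
  have hM0 : 0 ≤ M := (abs_nonneg _).trans (hM i)
  have h1 := N.one_le_betaOpt
  have h2 := N.decay_pos hlam
  have h3 : 1 - N.decay = N.betaOpt - 1 := by rw [decay]; ring
  rw [decay] at h2
  have h4 : ∀ j, |N.sosFlow x y i j| ≤
      (N.betaOpt - 1) * |(y i j : ℝ)| + N.betaOpt * |N.fosFlow x i j| := by
    intro j
    rw [sosFlow]
    refine (abs_add_le _ _).trans_eq ?_
    rw [abs_mul, abs_mul, abs_of_nonneg (by linarith : 0 ≤ N.betaOpt - 1),
      abs_of_nonneg (by linarith : 0 ≤ N.betaOpt)]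
  refine (Finset.sum_le_sum fun j _ => h4 j).trans ?_
  rw [Finset.sum_add_distrib, ← Finset.mul_sum, ← Finset.mul_sum, h3]
  have h5 := N.sum_abs_fosFlow_le x₀ x hM i
  nlinarith

theorem abs_sub_balanced_div_speed_le (x₀ : Fin n → ℕ) (j : Fin n) :
    |((x₀ j : ℝ) - N.balanced x₀ j) / N.speed j| ≤ N.discrepancy x₀ := by
  rw [abs_div, abs_of_pos (N.speed_pos j)]
  exact (div_le_self (abs_nonneg _) (N.one_le_speed j)).trans (N.abs_sub_balanced_le x₀ j)

theorem discrepancy_le_sqrt_mul (hn : 0 < n) (x₀ : Fin n → ℕ) :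
    N.discrepancy x₀ ≤ √n * N.discrepancy x₀ := by
  refine le_mul_of_one_le_left (N.discrepancy_nonneg x₀) ?_
  rw [Real.one_le_sqrt]
  exact_mod_cast hn

/-- The exponential moments of the total flow at a node: each round forgets a part of the flow and
adds a multiple of the current deviation from balance. -/
theorem expect_exp_flow_le (hn : 0 < n) (hlam : N.lam < 1) (x₀ : Fin n → ℕ) (t : ℕ) (i : Fin n)
    {θ : ℝ} (hθ : 0 ≤ θ) :
    expect (sosLaw N x₀ t) (fun σ => ENNReal.ofReal (Real.exp
      (N.decay * θ / 4 * ∑ j, |(σ.flow i j : ℝ)|))) ≤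
    ENNReal.ofReal (2 * n * Real.exp (θ * (N.maxDeg : ℝ) ^ 2 / 4 +
      (θ * (3 * (√n * N.discrepancy x₀)) +
        512 * ((N.maxDeg : ℝ) ^ 2 * θ ^ 2 / N.decay ^ 3)))) := by
  have hd := N.decay_pos hlam
  have hd1 := N.decay_le_one
  have hΔ := N.discrepancy_nonneg x₀
  set F : ℝ := θ * (3 * (√n * N.discrepancy x₀)) +
    512 * ((N.maxDeg : ℝ) ^ 2 * θ ^ 2 / N.decay ^ 3) with hF
  set E : ℝ := θ * (N.maxDeg : ℝ) ^ 2 / 4 with hE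
  have hE0 : 0 ≤ E := by positivity
  induction t with
  | zero =>
    rw [sosLaw, expect_map]
    refine expect_le_of_le fun y hy => ENNReal.ofReal_le_ofReal ?_
    have h1 := N.sum_abs_le_of_mem_support (N.isFlow_fosFlow fun i => (x₀ i : ℤ)) hy i
    have h2 := N.sum_abs_fosFlow_le x₀ (fun i => (x₀ i : ℤ))
      (fun j => by simpa using N.abs_sub_balanced_div_speed_le x₀ j) i
    have h3 : (1 : ℝ) ≤ 2 * n := by
      have : (1 : ℝ) ≤ n := by exact_mod_cast hn
      linarith
    refine le_trans (Real.exp_le_exp.2 ?_) (le_mul_of_one_le_left (Real.exp_pos _).le h3)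
    have h4 : N.decay * θ / 4 ≤ θ / 4 := by nlinarith
    have h5 := N.discrepancy_le_sqrt_mul hn x₀
    have h6 : 0 ≤ 512 * ((N.maxDeg : ℝ) ^ 2 * θ ^ 2 / N.decay ^ 3) := by positivity
    calc N.decay * θ / 4 * ∑ j, |(y i j : ℝ)|
        ≤ θ / 4 * (2 * N.discrepancy x₀ + (N.maxDeg : ℝ) ^ 2) := by
          refine mul_le_mul h4 (h1.trans (by linarith)) ?_ (by positivity)
          exact Finset.sum_nonneg fun j _ => abs_nonneg _
      _ ≤ E + F := by
        have := mul_le_mul_of_nonneg_left h5 hθ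
        have := mul_nonneg hθ hΔ
        rw [hE, hF]
        linarith
  | succ t ih =>
    rw [sosLaw, expect_bind]
    set G : ℝ := 2 * n * Real.exp (E + F) with hG
    set z : State n → Fin n → ℝ :=
      fun σ j => ((σ.nextLoad j : ℝ) - N.balanced x₀ j) / N.speed j with hz
    have hz0 : ∀ j, expect (sosLaw N x₀ t) (fun σ => ENNReal.ofReal (Real.exp (θ * z σ j)) +
        ENNReal.ofReal (Real.exp (-θ * z σ j))) ≤ ENNReal.ofReal (2 * Real.exp F) := by
      intro j
      have h1 := N.expect_exp_load_div_speed_le hn hlam x₀ t j θ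
      have h2 := N.expect_exp_load_div_speed_le hn hlam x₀ t j (-θ)
      rw [abs_of_nonneg hθ] at h1
      rw [abs_neg, abs_of_nonneg hθ, neg_sq] at h2
      rw [expect_add, two_mul, ENNReal.ofReal_add (Real.exp_pos _).le (Real.exp_pos _).le]
      exact add_le_add h1 h2
    have hstep : ∀ σ ∈ (sosLaw N x₀ t).support,
        expect ((randomizedRounding (N.sosFlow σ.nextLoad σ.flow)).map
          fun y => (⟨σ.nextLoad, y⟩ : State n)) (fun σ => ENNReal.ofReal (Real.exp
            (N.decay * θ / 4 * ∑ j, |(σ.flow i j : ℝ)|))) ≤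
        ENNReal.ofReal (1 - N.decay) * ENNReal.ofReal (Real.exp
            (N.decay * θ / 4 * ∑ j, |(σ.flow i j : ℝ)|)) +
          ENNReal.ofReal (N.decay * Real.exp E) * ∑ j, (ENNReal.ofReal (Real.exp (θ * z σ j)) +
            ENNReal.ofReal (Real.exp (-θ * z σ j))) := by
      intro σ hσ
      rw [expect_map]
      refine expect_le_of_le fun y hy => ?_
      have : Nonempty (Fin n) := ⟨⟨0, hn⟩⟩
      obtain ⟨k, hk⟩ := Finite.exists_max fun j => |z σ j|
      have h1 := N.sum_abs_le_of_mem_support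
        (N.isFlow_sosFlow σ.nextLoad (N.isFlow_of_mem_support_sosLaw x₀ t hσ)) hy i
      have h2 := N.sum_abs_sosFlow_le hlam x₀ σ.nextLoad σ.flow hk i
      set Ψ : ℝ := ∑ j, |(σ.flow i j : ℝ)|
      -- The scaling by (2-β)θ/4 makes the new exponent at most a convex combination with weights
      -- β-1 and 2-β, to which convexity of exp applies.
      have h3 : N.decay * θ / 4 * ∑ j, |(y i j : ℝ)| ≤
          (1 - N.decay) * (N.decay * θ / 4 * Ψ) + N.decay * (E + θ * |z σ k|) := by
        refine (mul_le_mul_of_nonneg_left (h1.trans (add_le_add_left h2 _))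
          (by positivity)).trans (le_of_eq ?_)
        rw [hE]
        ring
      have h4 : Real.exp ((1 - N.decay) * (N.decay * θ / 4 * Ψ) +
          N.decay * (E + θ * |z σ k|)) ≤
          (1 - N.decay) * Real.exp (N.decay * θ / 4 * Ψ) +
            N.decay * Real.exp (E + θ * |z σ k|) := by
        have := convexOn_exp.2 (Set.mem_univ (N.decay * θ / 4 * Ψ))
          (Set.mem_univ (E + θ * |z σ k|)) (sub_nonneg.2 hd1) hd.le (by ring)
        simpa only [smul_eq_mul] using this
      have h5 : ∀ j, 0 ≤ Real.exp (θ * z σ j) + Real.exp (-θ * z σ j) := fun j => by positivity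
      -- The maximum is replaced by a sum over all nodes and both signs, the origin of the factor
      -- 2n.
      have h6 : Real.exp (θ * |z σ k|) ≤
          ∑ j, (Real.exp (θ * z σ j) + Real.exp (-θ * z σ j)) := by
        refine le_trans ?_ (Finset.single_le_sum (fun j _ => h5 j) (Finset.mem_univ k))
        rcases abs_cases (z σ k) with ⟨h, -⟩ | ⟨h, -⟩
        · rw [h]
          linarith [Real.exp_pos (-θ * z σ k)]
        · rw [h, mul_neg, ← neg_mul]
          linarith [Real.exp_pos (θ * z σ k)]
      have h7 : Real.exp (N.decay * θ / 4 * ∑ j, |(y i j : ℝ)|) ≤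
          (1 - N.decay) * Real.exp (N.decay * θ / 4 * Ψ) + (N.decay * Real.exp E) *
            ∑ j, (Real.exp (θ * z σ j) + Real.exp (-θ * z σ j)) := by
        refine (Real.exp_le_exp.2 h3).trans (h4.trans (add_le_add_right ?_ _))
        rw [Real.exp_add, ← mul_assoc]
        exact mul_le_mul_of_nonneg_left h6 (by positivity)
      refine (ENNReal.ofReal_le_ofReal h7).trans (ENNReal.ofReal_add_le.trans (le_of_eq ?_))
      rw [ENNReal.ofReal_mul (sub_nonneg.2 hd1), ENNReal.ofReal_mul (by positivity),
        ENNReal.ofReal_sum_of_nonneg fun j _ => h5 j]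
      simp only [ENNReal.ofReal_add (Real.exp_pos _).le (Real.exp_pos _).le]
    refine (expect_mono hstep).trans ?_
    rw [expect_add, expect_const_mul, expect_const_mul, expect_sum]
    have h8 := Finset.sum_le_sum fun j (_ : j ∈ Finset.univ) => hz0 j
    -- G is the fixed point of the resulting affine recursion, so the bound does not grow with t.
    have h9 : ENNReal.ofReal G = ENNReal.ofReal (1 - N.decay) * ENNReal.ofReal G +
        ENNReal.ofReal (N.decay * Real.exp E) * ∑ _j : Fin n, ENNReal.ofReal (2 * Real.exp F) := by
      rw [← ENNReal.ofReal_sum_of_nonneg fun j _ => by positivity,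
        ← ENNReal.ofReal_mul (sub_nonneg.2 hd1), ← ENNReal.ofReal_mul (by positivity),
        ← ENNReal.ofReal_add (mul_nonneg (sub_nonneg.2 hd1) (by positivity)) (by positivity)]
      congr 1
      rw [hG, Finset.sum_const, Finset.card_univ, Fintype.card_fin, nsmul_eq_mul, Real.exp_add]
      ring
    rw [h9]
    exact add_le_add (mul_le_mul_right ih _) (mul_le_mul_right h8 _)

theorem expect_sosLaw_succ_load (x₀ : Fin n → ℕ) (t : ℕ) (f : (Fin n → ℤ) → ℝ≥0∞) :
    expect (sosLaw N x₀ (t + 1)) (fun σ => f σ.load) =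
      expect (sosLaw N x₀ t) (fun σ => f σ.nextLoad) := by
  rw [sosLaw, expect_bind]
  simp only [expect_map, expect_const]

/-- Scaling θ by √(1-λ) cancels the factor 1/√(1-λ) in the mean and 1/(1-λ) in the variance. Round 0
is separate, as the moment bounds concern the load after a round. -/
theorem expect_exp_neg_load_le (hn : 0 < n) (hlam : N.lam < 1) (x₀ : Fin n → ℕ) (t : ℕ)
    (k : Fin n) {θ : ℝ} (hθ : 0 ≤ θ) {κ : ℝ} (hκ0 : 0 < κ) (hκ1 : κ ≤ 1) :
    expect (sosLaw N x₀ t) (fun σ => ENNReal.ofReal (Real.exp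
      (-(√(1 - N.lam) * θ) * ((σ.load k : ℝ) - N.balanced x₀ k)))) ≤
    ENNReal.ofReal (Real.exp (θ * (6 * (√n * N.discrepancy x₀)) +
      640 / κ * ((N.maxDeg : ℝ) ^ 2 * θ ^ 2 * N.speed k ^ κ / N.decay ^ 3))) := by
  have hη := N.sqrt_one_sub_lam_pos hlam
  have hη1 : √(1 - N.lam) ≤ 1 := Real.sqrt_le_one.2 (by linarith [N.lam_nonneg])
  have hd := N.decay_pos hlam
  have hΔ := N.discrepancy_nonneg x₀
  cases t with
  | zero =>
    rw [sosLaw, expect_map]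
    refine expect_le_of_le fun y _ => ENNReal.ofReal_le_ofReal (Real.exp_le_exp.2 ?_)
    have h0 : 0 ≤ 640 / κ * ((N.maxDeg : ℝ) ^ 2 * θ ^ 2 * N.speed k ^ κ / N.decay ^ 3) := by
      have := Real.rpow_nonneg (N.speed_pos k).le κ
      positivity
    have h1 := (abs_le.1 (N.abs_sub_balanced_le x₀ k)).1
    have h2 := N.discrepancy_le_sqrt_mul hn x₀
    have h3 : √(1 - N.lam) * θ ≤ θ := mul_le_of_le_one_left hθ hη1
    have h4 := mul_le_mul_of_nonneg_left h1 (by positivity : 0 ≤ √(1 - N.lam) * θ)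
    have h5 := mul_le_mul_of_nonneg_right h3 hΔ
    have h6 := mul_le_mul_of_nonneg_left h2 hθ
    have h7 := mul_nonneg hθ hΔ
    push_cast
    linarith
  | succ t =>
    rw [N.expect_sosLaw_succ_load x₀ t fun x => ENNReal.ofReal (Real.exp
      (-(√(1 - N.lam) * θ) * ((x k : ℝ) - N.balanced x₀ k)))]
    refine (N.expect_exp_load_single_le hn hlam x₀ t k _ hκ0 hκ1).trans (le_of_eq ?_)
    rw [abs_neg, abs_of_nonneg (by positivity : 0 ≤ √(1 - N.lam) * θ), neg_sq, mul_pow,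
      Real.sq_sqrt (by linarith)]
    have : 1 - N.lam ≠ 0 := by linarith
    congr 3
    · field_simp
    · field_simp

/-! ### The transient load -/

theorem neg_le_transientLoad (x₀ : Fin n → ℕ) (σ : State n) (i : Fin n) {A : ℝ}
    (h1 : ∑ j, |(σ.flow i j : ℝ)| ≤ A) (h2 : -A ≤ (σ.load i : ℝ) - N.balanced x₀ i) :
    -(2 * A) ≤ (σ.transientLoad i : ℝ) := by
  have h3 := N.balanced_nonneg x₀ i
  have h4 : ∑ j, max (σ.flow i j : ℝ) 0 ≤ ∑ j, |(σ.flow i j : ℝ)| :=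
    Finset.sum_le_sum fun j _ => max_le (le_abs_self _) (abs_nonneg _)
  have h5 : (σ.transientLoad i : ℝ) = (σ.load i : ℝ) - ∑ j, max (σ.flow i j : ℝ) 0 := by
    rw [State.transientLoad]
    push_cast
    rfl
  linarith

/-- The probability that a transient load is below `-(2 * A)`. -/
theorem one_sub_le_transientLoad (hn : 0 < n) (hlam : N.lam < 1) (x₀ : Fin n → ℕ) (t : ℕ)
    {θ : ℝ} (hθ : 0 < θ) {κ : ℝ} (hκ0 : 0 < κ) (hκ1 : κ ≤ 1) {A b : ℝ}
    (hb : ∀ i, N.speed i ^ κ ≤ b) :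
    1 - ENNReal.ofReal (n * (2 * n * Real.exp (θ * (N.maxDeg : ℝ) ^ 2 / 4 +
      (θ * (3 * (√n * N.discrepancy x₀)) +
        512 * ((N.maxDeg : ℝ) ^ 2 * θ ^ 2 / N.decay ^ 3)) - √(1 - N.lam) * θ / 4 * A) +
      Real.exp (θ * (6 * (√n * N.discrepancy x₀)) +
        640 / κ * ((N.maxDeg : ℝ) ^ 2 * θ ^ 2 * b / N.decay ^ 3) - √(1 - N.lam) * θ * A))) ≤
    (sosLaw N x₀ t).toOuterMeasure {σ | ∀ i, -(2 * A) ≤ (σ.transientLoad i : ℝ)} := by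
  have hη := N.sqrt_one_sub_lam_pos hlam
  have hd := N.decay_pos hlam
  -- For negative A the second exponential is already at least 1, so the left side is zero.
  rcases lt_or_ge A 0 with hA | hA
  · refine le_trans (le_of_eq (tsub_eq_zero_of_le ?_)) zero_le
    have h1 : (1 : ℝ) ≤ n := by exact_mod_cast hn
    have h3 := N.discrepancy_nonneg x₀
    have hb0 : 0 ≤ b := (Real.rpow_nonneg (N.speed_pos ⟨0, hn⟩).le κ).trans (hb ⟨0, hn⟩)
    have h2 : 1 ≤ Real.exp (θ * (6 * (√n * N.discrepancy x₀)) +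
        640 / κ * ((N.maxDeg : ℝ) ^ 2 * θ ^ 2 * b / N.decay ^ 3) - √(1 - N.lam) * θ * A) := by
      refine Real.one_le_exp ?_
      have h4 : 0 ≤ √(1 - N.lam) * θ * (-A) := mul_nonneg (by positivity) (by linarith)
      have h5 : 0 ≤ θ * (6 * (√n * N.discrepancy x₀)) +
        640 / κ * ((N.maxDeg : ℝ) ^ 2 * θ ^ 2 * b / N.decay ^ 3) := by positivity
      linarith
    rw [ENNReal.one_le_ofReal]
    have h4 : 0 ≤ 2 * n * Real.exp (θ * (N.maxDeg : ℝ) ^ 2 / 4 +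
      (θ * (3 * (√n * N.discrepancy x₀)) +
        512 * ((N.maxDeg : ℝ) ^ 2 * θ ^ 2 / N.decay ^ 3)) - √(1 - N.lam) * θ / 4 * A) := by
      positivity
    nlinarith
  set f : State n → ℝ≥0∞ := fun σ => ∑ i,
    (ENNReal.ofReal (Real.exp (-(√(1 - N.lam) * θ / 4 * A))) * ENNReal.ofReal (Real.exp
      (N.decay * θ / 4 * ∑ j, |(σ.flow i j : ℝ)|)) +
    ENNReal.ofReal (Real.exp (-(√(1 - N.lam) * θ * A))) * ENNReal.ofReal (Real.exp
      (-(√(1 - N.lam) * θ) * ((σ.load i : ℝ) - N.balanced x₀ i)))) with hf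
  refine le_trans (tsub_le_tsub_left ?_ 1) (one_sub_expect_le (sosLaw N x₀ t) _ f ?_)
  · rw [hf, expect_sum]
    have h1 : ∀ i ∈ (Finset.univ : Finset (Fin n)), expect (sosLaw N x₀ t) (fun σ =>
        ENNReal.ofReal (Real.exp (-(√(1 - N.lam) * θ / 4 * A))) * ENNReal.ofReal (Real.exp
          (N.decay * θ / 4 * ∑ j, |(σ.flow i j : ℝ)|)) +
        ENNReal.ofReal (Real.exp (-(√(1 - N.lam) * θ * A))) * ENNReal.ofReal (Real.exp
          (-(√(1 - N.lam) * θ) * ((σ.load i : ℝ) - N.balanced x₀ i)))) ≤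
        ENNReal.ofReal (2 * n * Real.exp (θ * (N.maxDeg : ℝ) ^ 2 / 4 +
          (θ * (3 * (√n * N.discrepancy x₀)) +
            512 * ((N.maxDeg : ℝ) ^ 2 * θ ^ 2 / N.decay ^ 3)) - √(1 - N.lam) * θ / 4 * A) +
          Real.exp (θ * (6 * (√n * N.discrepancy x₀)) +
            640 / κ * ((N.maxDeg : ℝ) ^ 2 * θ ^ 2 * b / N.decay ^ 3) -
              √(1 - N.lam) * θ * A)) := by
      intro i _
      rw [expect_add, expect_const_mul, expect_const_mul,
        ENNReal.ofReal_add (by positivity) (Real.exp_pos _).le]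
      refine add_le_add
        ((mul_le_mul_right (N.expect_exp_flow_le hn hlam x₀ t i hθ.le) _).trans (le_of_eq ?_))
        ((mul_le_mul_right (N.expect_exp_neg_load_le hn hlam x₀ t i hθ.le hκ0 hκ1) _).trans ?_)
      · rw [← ENNReal.ofReal_mul (Real.exp_pos _).le, Real.exp_sub, Real.exp_neg, div_eq_mul_inv]
        congr 1
        ring
      · rw [← ENNReal.ofReal_mul (Real.exp_pos _).le, ← Real.exp_add]
        refine ENNReal.ofReal_le_ofReal (Real.exp_le_exp.2 ?_)
        have h2 : 640 / κ * ((N.maxDeg : ℝ) ^ 2 * θ ^ 2 * N.speed i ^ κ / N.decay ^ 3) ≤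
            640 / κ * ((N.maxDeg : ℝ) ^ 2 * θ ^ 2 * b / N.decay ^ 3) := by
          have := hb i
          gcongr
        linarith
    refine (Finset.sum_le_sum h1).trans (le_of_eq ?_)
    rw [Finset.sum_const, Finset.card_univ, Fintype.card_fin, nsmul_eq_mul,
      ENNReal.ofReal_mul (Nat.cast_nonneg n), ENNReal.ofReal_natCast]
  · intro σ _ hσ
    simp only [Set.mem_ofPred_eq, not_forall] at hσ
    obtain ⟨i, hi⟩ := hσ
    refine le_trans ?_ (Finset.single_le_sum (fun j _ => zero_le) (Finset.mem_univ i))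
    simp only [← ENNReal.ofReal_mul (Real.exp_pos _).le, ← Real.exp_add]
    by_cases h1 : ∑ j, |(σ.flow i j : ℝ)| ≤ A
    · refine le_trans ?_ le_add_self
      rw [ENNReal.one_le_ofReal]
      refine Real.one_le_exp ?_
      have h2 : (σ.load i : ℝ) - N.balanced x₀ i < -A := by
        by_contra h2
        exact hi (N.neg_le_transientLoad x₀ σ i h1 (not_lt.1 h2))
      have : 0 < √(1 - N.lam) * θ := by positivity
      nlinarith
    · refine le_trans ?_ le_self_add
      rw [ENNReal.one_le_ofReal]
      refine Real.one_le_exp ?_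
      have h2 := N.sqrt_one_sub_lam_le_decay hlam
      have h3 : √(1 - N.lam) * θ / 4 * A ≤ N.decay * θ / 4 * ∑ j, |(σ.flow i j : ℝ)| := by
        refine mul_le_mul ?_ (not_le.1 h1).le hA (by positivity)
        gcongr
      linarith

/-- A balanced initial load does not move. -/
theorem eq_of_mem_support_sosLaw_of_discrepancy_eq_zero {x₀ : Fin n → ℕ}
    (h0 : N.discrepancy x₀ = 0) (t : ℕ) {σ : State n} (h : σ ∈ (sosLaw N x₀ t).support) :
    σ.load = (fun i => (x₀ i : ℤ)) ∧ σ.flow = 0 := by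
  have hfos : ∀ i j, N.fosFlow (fun i => (x₀ i : ℤ)) i j = 0 := by
    intro i j
    have h1 : ∀ k, (x₀ k : ℝ) = N.balanced x₀ k := by
      intro k
      have := N.abs_sub_balanced_le x₀ k
      rw [h0] at this
      linarith [abs_nonpos_iff.1 this]
    rw [fosFlow]
    simp only [Int.cast_natCast]
    rw [h1 i, h1 j, balanced_div_speed, balanced_div_speed, sub_self, mul_zero]
  induction t generalizing σ with
  | zero =>
    rw [sosLaw, PMF.mem_support_map_iff] at h
    obtain ⟨y, hy, rfl⟩ := h
    refine ⟨rfl, ?_⟩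
    ext i j
    exact eq_zero_of_mem_support_randomizedRounding hy (hfos i j)
  | succ t ih =>
    rw [sosLaw, PMF.mem_support_bind_iff] at h
    obtain ⟨τ, hτ, h⟩ := h
    rw [PMF.mem_support_map_iff] at h
    obtain ⟨y, hy, rfl⟩ := h
    obtain ⟨h1, h2⟩ := ih hτ
    have h3 : τ.nextLoad = fun i => (x₀ i : ℤ) := by
      ext i
      simp [State.nextLoad, h1, h2]
    refine ⟨h3, ?_⟩
    ext i j
    refine eq_zero_of_mem_support_randomizedRounding hy ?_
    rw [sosFlow, h3, hfos, h2]
    simp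

theorem one_le_transientLoad_of_discrepancy_eq_zero {x₀ : Fin n → ℕ}
    (h0 : N.discrepancy x₀ = 0) (t : ℕ) {A : ℝ} (hA : 0 ≤ A) :
    1 ≤ (sosLaw N x₀ t).toOuterMeasure {σ | ∀ i, -A ≤ (σ.transientLoad i : ℝ)} := by
  have h := one_sub_expect_le (sosLaw N x₀ t) {σ | ∀ i, -A ≤ (σ.transientLoad i : ℝ)}
    (fun _ => 0) (fun σ hσ hn => by
      refine absurd (fun i => ?_) hn
      obtain ⟨h1, h2⟩ := N.eq_of_mem_support_sosLaw_of_discrepancy_eq_zero h0 t hσ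
      have h3 : (0 : ℝ) ≤ x₀ i := Nat.cast_nonneg _
      simp only [State.transientLoad, h1, h2, Pi.zero_apply, max_self, Finset.sum_const_zero,
        sub_zero, Int.cast_natCast]
      linarith)
  rwa [expect_const, tsub_zero] at h

/-- The variance of the rounding errors, under the assumption on the spectral gap. -/
theorem variance_le {ε K : ℝ} (hn : (1 : ℝ) ≤ n) (hlam : N.lam < 1)
    (hd : (N.maxDeg : ℝ) / (1 - N.lam) ^ (3 / 4 : ℝ) ≤ K * (n : ℝ) ^ (1 / 2 - ε)) :
    (N.maxDeg : ℝ) ^ 2 * ((n : ℝ) ^ ((ε - 1) / 2)) ^ 2 / N.decay ^ 3 * (n : ℝ) ^ ε ≤ K ^ 2 := by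
  have hn0 : (0 : ℝ) < n := by linarith
  have hη := N.sqrt_one_sub_lam_pos hlam
  have hη1 := N.sqrt_one_sub_lam_le_decay hlam
  have h1 : (N.maxDeg : ℝ) ^ 2 / √(1 - N.lam) ^ 3 ≤ (K * (n : ℝ) ^ (1 / 2 - ε)) ^ 2 := by
    have h2 : √(1 - N.lam) ^ 3 = ((1 - N.lam) ^ (3 / 4 : ℝ)) ^ 2 := by
      rw [Real.sqrt_eq_rpow, ← Real.rpow_natCast, ← Real.rpow_natCast,
        ← Real.rpow_mul (by linarith), ← Real.rpow_mul (by linarith)]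
      norm_num
    rw [h2, ← div_pow]
    refine pow_le_pow_left₀ (div_nonneg (Nat.cast_nonneg _) ?_) hd 2
    exact Real.rpow_nonneg (by linarith) _
  have h2 : (N.maxDeg : ℝ) ^ 2 / N.decay ^ 3 ≤ (K * (n : ℝ) ^ (1 / 2 - ε)) ^ 2 := by
    refine le_trans ?_ h1
    gcongr
  set θ : ℝ := (n : ℝ) ^ ((ε - 1) / 2) with hθ
  calc (N.maxDeg : ℝ) ^ 2 * θ ^ 2 / N.decay ^ 3 * (n : ℝ) ^ ε =
      (N.maxDeg : ℝ) ^ 2 / N.decay ^ 3 * (θ ^ 2 * (n : ℝ) ^ ε) := by ring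
    _ ≤ (K * (n : ℝ) ^ (1 / 2 - ε)) ^ 2 * (θ ^ 2 * (n : ℝ) ^ ε) := by gcongr
    _ = K ^ 2 * ((n : ℝ) ^ ((1 / 2 - ε) * 2) * (n : ℝ) ^ ((ε - 1) / 2 * 2) * (n : ℝ) ^ ε) := by
      rw [hθ, Real.rpow_mul hn0.le _ 2, Real.rpow_mul hn0.le _ 2, Real.rpow_two, Real.rpow_two]
      ring
    _ = K ^ 2 := by
      rw [← Real.rpow_add hn0, ← Real.rpow_add hn0,
        show (1 / 2 - ε) * 2 + (ε - 1) / 2 * 2 + ε = 0 by ring, Real.rpow_zero, mul_one]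

end Network

/-! ### Choice of the parameters and conclusion -/

theorem three_mul_sq_mul_exp_le {x ε c δ z : ℝ} (hx : 1 ≤ x) (hε : 0 < ε) (hc : 0 < c)
    (hδ : 0 < δ) (hz : δ * x ^ (ε / 2) ≤ z) :
    3 * x ^ 2 * Real.exp (c - (c + 2 + 6 / ε) / δ * z) ≤ x⁻¹ := by
  have hx0 : 0 < x := by linarith
  set y : ℝ := x ^ (ε / 2) with hy
  have hy1 : 1 ≤ y := Real.one_le_rpow hx (by positivity)
  -- Thus 3 log x ≤ (6/ε)y, which pays for x² and for the final x⁻¹; the term (c+2)y pays for c and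
  -- for 3 ≤ e².
  have hlog : Real.log x ≤ y / (ε / 2) := Real.log_le_rpow_div hx0.le (by positivity)
  have h1 : (c + 2 + 6 / ε) / δ * (δ * y) = (c + 2) * y + 6 / ε * y := by
    field_simp
  have h2 := mul_le_mul_of_nonneg_left hz (by positivity : 0 ≤ (c + 2 + 6 / ε) / δ)
  have h3 : (3 : ℝ) ≤ Real.exp 2 := by linarith [Real.add_one_le_exp (2 : ℝ)]
  have h4 : x ^ 2 = Real.exp (2 * Real.log x) := by
    rw [mul_comm, Real.exp_mul, Real.exp_log hx0, Real.rpow_two]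
  have h5 : x⁻¹ = Real.exp (-Real.log x) := by rw [Real.exp_neg, Real.exp_log hx0]
  have h6 : y / (ε / 2) * 3 = 6 / ε * y := by
    field_simp
    norm_num
  have h7 : c + 2 ≤ (c + 2) * y := le_mul_of_one_le_right (by linarith) hy1
  calc 3 * x ^ 2 * Real.exp (c - (c + 2 + 6 / ε) / δ * z)
      ≤ Real.exp 2 * Real.exp (2 * Real.log x) *
        Real.exp (c - (c + 2 + 6 / ε) / δ * z) := by
        rw [h4]
        gcongr
    _ ≤ x⁻¹ := by
      rw [h5, ← Real.exp_add, ← Real.exp_add]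
      refine Real.exp_le_exp.2 ?_
      linarith

end LoadBalancing

theorem mainTheorem6 :
    ∃ a : ℝ, 0 < a ∧
      ∀ (ε : ℝ) (_ : 0 < ε) (K : ℝ) (_ : 0 < K) (p : ℕ) (δ : ℝ) (_ : 0 < δ),
        ∃ C : ℝ, 0 < C ∧
          ∀ (n : ℕ) (N : LoadBalancing.Network n) (x₀ : Fin n → ℕ),
            (∀ i, N.speed i ≤ K * (n : ℝ) ^ p) →
            N.lam < 1 →
            (N.maxDeg : ℝ) / (1 - N.lam) ^ (3 / 4 : ℝ) ≤ K * (n : ℝ) ^ (1 / 2 - ε) →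
            (N.discrepancy x₀ = 0 ∨ δ ≤ N.discrepancy x₀) →
            ∀ t : ℕ,
              ENNReal.ofReal (1 - (n : ℝ) ^ (-a)) ≤
                (LoadBalancing.sosLaw N x₀ t).toOuterMeasure
                  {σ | ∀ i, -(C * ((√(n : ℝ) * N.discrepancy x₀ + (N.maxDeg : ℝ) ^ 2) /
                      √(1 - N.lam))) ≤ (σ.transientLoad i : ℝ)} := by
  refine ⟨1, one_pos, fun ε hε K hK p δ hδ => ?_⟩
  -- Small enough that pκ ≤ ε: a speed to the power κ then costs at most K^κ n^ε.
  set κ : ℝ := ε / (p + 1 + ε) with hκ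
  have hκ0 : 0 < κ := by positivity
  have hκ1 : κ ≤ 1 := by
    rw [hκ, div_le_one (by positivity)]
    have : (0 : ℝ) ≤ p := Nat.cast_nonneg p
    linarith
  set c : ℝ := 512 * K ^ 2 + 640 / κ * (K ^ 2 * K ^ κ) with hc
  set C₀ : ℝ := (c + 2 + 6 / ε) / δ with hC₀
  have hc0 : 0 < c := by positivity
  have hC₀0 : 0 < C₀ := by positivity
  -- This is 2A for A = 4(C₀+6)X/√(1-λ). The 4 offsets the quarter in the flow exponent, the 6
  -- absorbs the terms linear in θ, and C₀ is left to beat log n.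
  refine ⟨8 * (C₀ + 6), by positivity, fun n N x₀ hs hlam hd hΔ t => ?_⟩
  have hη := N.sqrt_one_sub_lam_pos hlam
  have hη1 := N.sqrt_one_sub_lam_le_decay hlam
  have hΔ0 := N.discrepancy_nonneg x₀
  rcases hΔ with hΔ | hΔ
  · refine le_trans ?_ (N.one_le_transientLoad_of_discrepancy_eq_zero hΔ t (by positivity))
    rw [← ENNReal.ofReal_one]
    refine ENNReal.ofReal_le_ofReal ?_
    linarith [Real.rpow_nonneg (Nat.cast_nonneg n : (0 : ℝ) ≤ n) (-1)]
  rcases Nat.eq_zero_or_pos n with hn | hn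
  · subst hn
    have h : N.discrepancy x₀ = 0 := by
      have h0 : (fun i => (x₀ i : ℝ) - N.balanced x₀ i) = 0 := Subsingleton.elim _ _
      rw [LoadBalancing.Network.discrepancy, h0, norm_zero]
    linarith
  have hn1 : (1 : ℝ) ≤ n := by exact_mod_cast hn
  have hn0 : (0 : ℝ) < n := by linarith
  set X : ℝ := √(n : ℝ) * N.discrepancy x₀ + (N.maxDeg : ℝ) ^ 2 with hX
  -- Large enough that θ√n = n^(ε/2), yet small enough that the gap assumption bounds the variance
  -- with n^ε to spare for the speeds.
  set θ : ℝ := (n : ℝ) ^ ((ε - 1) / 2) with hθ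
  have hθ0 : 0 < θ := Real.rpow_pos_of_pos hn0 _
  have hb : ∀ i, N.speed i ^ κ ≤ K ^ κ * (n : ℝ) ^ ε := by
    intro i
    calc N.speed i ^ κ ≤ (K * (n : ℝ) ^ p) ^ κ :=
          Real.rpow_le_rpow (N.speed_pos i).le (hs i) hκ0.le
      _ = K ^ κ * (n : ℝ) ^ (p * κ) := by
        rw [Real.mul_rpow hK.le (by positivity), Real.rpow_mul hn0.le, Real.rpow_natCast]
      _ ≤ K ^ κ * (n : ℝ) ^ ε := by
        refine mul_le_mul_of_nonneg_left (Real.rpow_le_rpow_of_exponent_le hn1 ?_) (by positivity)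
        rw [hκ, mul_div_assoc', div_le_iff₀ (by positivity)]
        nlinarith
  have hV := N.variance_le hn1 hlam hd
  rw [← hθ] at hV
  have hV0 : 0 ≤ (N.maxDeg : ℝ) ^ 2 * θ ^ 2 / N.decay ^ 3 := by
    have := N.decay_pos hlam
    positivity
  have hV1 : (N.maxDeg : ℝ) ^ 2 * θ ^ 2 / N.decay ^ 3 ≤ K ^ 2 :=
    (le_mul_of_one_le_right hV0 (Real.one_le_rpow hn1 hε.le)).trans hV
  have hV2 : (N.maxDeg : ℝ) ^ 2 * θ ^ 2 * (K ^ κ * (n : ℝ) ^ ε) / N.decay ^ 3 ≤ K ^ 2 * K ^ κ := by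
    have := mul_le_mul_of_nonneg_right hV (by positivity : 0 ≤ K ^ κ)
    refine le_trans (le_of_eq ?_) this
    ring
  set y : ℝ := (n : ℝ) ^ (ε / 2) with hy
  have hy1 : 1 ≤ y := Real.one_le_rpow hn1 (by positivity)
  have hmain : δ * y ≤ θ * (√(n : ℝ) * N.discrepancy x₀) := by
    have h1 : θ * √(n : ℝ) = y := by
      rw [hθ, hy, Real.sqrt_eq_rpow, ← Real.rpow_add hn0]
      congr 1
      ring
    rw [← mul_assoc, h1, mul_comm]
    gcongr
  have hbound := LoadBalancing.three_mul_sq_mul_exp_le hn1 hε hc0 hδ hmain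
  rw [← hC₀] at hbound
  have key := N.one_sub_le_transientLoad hn hlam x₀ t hθ0 hκ0 hκ1
    (A := 4 * (C₀ + 6) * (X / √(1 - N.lam))) hb
  have hset : 2 * (4 * (C₀ + 6) * (X / √(1 - N.lam))) = 8 * (C₀ + 6) * (X / √(1 - N.lam)) := by
    ring
  rw [hset] at key
  refine le_trans ?_ key
  rw [ENNReal.ofReal_sub _ (Real.rpow_nonneg hn0.le _), ENNReal.ofReal_one, Real.rpow_neg_one]
  refine tsub_le_tsub_left (ENNReal.ofReal_le_ofReal (le_trans ?_ hbound)) 1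
  have hηX : ∀ s : ℝ, √(1 - N.lam) * s * (4 * (C₀ + 6) * (X / √(1 - N.lam))) =
      s * (4 * (C₀ + 6) * X) := by
    intro s
    field_simp
  have hdeg : 0 ≤ θ * (N.maxDeg : ℝ) ^ 2 := by positivity
  have hdev : 0 ≤ θ * (√(n : ℝ) * N.discrepancy x₀) := by positivity
  have e1 : θ * (N.maxDeg : ℝ) ^ 2 / 4 + (θ * (3 * (√(n : ℝ) * N.discrepancy x₀)) +
      512 * ((N.maxDeg : ℝ) ^ 2 * θ ^ 2 / N.decay ^ 3)) -
      √(1 - N.lam) * θ / 4 * (4 * (C₀ + 6) * (X / √(1 - N.lam))) ≤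
      c - C₀ * (θ * (√(n : ℝ) * N.discrepancy x₀)) := by
    rw [mul_div_assoc _ θ 4, hηX, hX, hc]
    have : 0 ≤ 640 / κ * (K ^ 2 * K ^ κ) := by positivity
    have := mul_nonneg hC₀0.le hdeg
    linarith
  have e2 : θ * (6 * (√(n : ℝ) * N.discrepancy x₀)) +
      640 / κ * ((N.maxDeg : ℝ) ^ 2 * θ ^ 2 * (K ^ κ * (n : ℝ) ^ ε) / N.decay ^ 3) -
      √(1 - N.lam) * θ * (4 * (C₀ + 6) * (X / √(1 - N.lam))) ≤
      c - C₀ * (θ * (√(n : ℝ) * N.discrepancy x₀)) := by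
    rw [hηX, hX, hc]
    have := mul_le_mul_of_nonneg_left hV2 (by positivity : 0 ≤ 640 / κ)
    have := mul_nonneg hC₀0.le hdeg
    have := mul_nonneg hC₀0.le hdev
    have : 0 ≤ 512 * K ^ 2 := by positivity
    linarith
  have e3 := Real.exp_le_exp.2 e1
  have e4 := Real.exp_le_exp.2 e2
  set W := Real.exp (c - C₀ * (θ * (√(n : ℝ) * N.discrepancy x₀))) with hW
  have hW0 : 0 < W := Real.exp_pos _
  calc _ ≤ (n : ℝ) * (2 * n * W + W) := by gcongr
    _ ≤ (n : ℝ) * (2 * n * W + n * W) := by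
      gcongr
      exact le_mul_of_one_le_left hW0.le hn1
    _ = 3 * (n : ℝ) ^ 2 * W := by ring
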